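/- **Theorem 2.** Let $G$ be any group. For a set $\mathcal C$ of subgroups of $G$, a *Mackey system* $(\mathcal C,\mathcal O)$ requires $\mathcal C$ to be closed under conjugation and finite intersections, and consists of sets $\mathcal O(H)\subseteq\mathcal C(H)=\{U\in\mathcal C: U\le H\}$ ($H\in\mathcal C$) such that $[H:U]<\infty$, $\mathcal O(U)\subseteq\mathcal O(H)$, $\mathcal O(gHg^{-1})=g\mathcal O(H)g^{-1}$ and $U\cap V\in\mathcal O(V)$ for all $H\in\mathcal C$, $U\in\mathcal O(H)$, $V\in\mathcal C(H)$, $g\in G$. A *Tambara system* $(\mathcal C,\mathcal O_{\mathcal C},\mathcal O_\bullet)$ on $G$ is given by a set $\widetilde{\mathcal C}$ of subsets of $G$ closed under left and right translation, finite intersections and finite unions, with $\mathcal C=\{H\in\widetilde{\mathcal C}: H\le G\}$, $\mathcal O_{\mathcal C}(H)=\{U\in\mathcal C(H):[H:U]<\infty\}$, and a Mackey system $(\mathcal C,\mathcal O_\bullet)$ with $H\in\mathcal O_\bullet(H)$ for all $H\in\mathcal C$. Let ${}_G\mathrm{Set}_{\mathcal C}$ be the category of $G$-sets all of whose stabilizers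 lie in $\mathcal C$ and equivariant maps, and ${}_G\mathrm{Set}_{\mathcal C,\mathcal O}$ the subcategory with the same objects and with those $f:X\to Y$ that have finite fibers and satisfy $G_x\in\mathcal O(G_{f(x)})$ for all $x\in X$. A *semi-Mackey functor* $M=(M^*,M_*)$ on $(\mathcal C,\mathcal O)$ consists of a contravariant functor $M^*$ on ${}_G\mathrm{Set}_{\mathcal C}$ and a covariant functor $M_*$ on ${}_G\mathrm{Set}_{\mathcal C,\mathcal O}$ to commutative monoids, which agree on objects, satisfy the Mackey (base change) condition for pull-back squares, and such that $M^*$ takes arbitrary coproducts to products. Morphisms are families of monoid homomorphisms natural for $M^*$ and $M_*$. Let $\mathit{SMack}$ be the category of semi-Mackey functors on $(\mathcal C,\mathcal O_\bullet)$. For $\eta:X\to Y$ in ${}_G\mathrm{Set}_{\mathcal C,\mathcal O_\bullet}$ and $p:A\to X$ in ${}_G\mathrm{Set}_{\mathcal C,\mathcal O_{\mathcal C}}$ (that is, with finite fibers) let $\Pi_\eta(A)$ be the set of pairs $(y,\sigma)$ of a point $y\in Y$ and a section $\sigma:\eta^{-1}(y)\to A$ of $p$, with projection $\pi:\Pi_\eta(A)\to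 Y$, evaluation $\lambda:X\times_Y\Pi_\eta(A)\to A$, and projection $\rho:X\times_Y\Pi_\eta(A)\to\Pi_\eta(A)$. The diagrams isomorphic to $X\xleftarrow{p}A\xleftarrow{\lambda}X\times_Y\Pi_\eta(A)\xrightarrow{\rho}\Pi_\eta(A)\xrightarrow{\pi}Y$ (together with $\eta:X\to Y$) are the *exponential diagrams*. A *semi-Tambara functor* $S=(S^*,S_+,S_\bullet)$ assigns to every $X$ in ${}_G\mathrm{Set}_{\mathcal C}$ a commutative semiring $S(X)$ such that $(S^*,S_+)$ is a semi-Mackey functor on $(\mathcal C,\mathcal O_{\mathcal C})$ for the additive monoids, $(S^*,S_\bullet)$ is a semi-Mackey functor on $(\mathcal C,\mathcal O_\bullet)$ for the multiplicative monoids, and $S_+(\upsilon)S_\bullet(\eta')S^*(\zeta)=S_\bullet(\eta)S_+(\xi)$ for every exponential diagram $X\xleftarrow{\xi}Z\xleftarrow{\zeta}X'\xrightarrow{\eta'}Y'\xrightarrow{\upsilon}Y$ over $\eta$. Morphisms are families of semiring homomorphisms compatible with $S^*,S_+,S_\bullet$; the category is $\mathit{STam}$. The forgetful functor $\mu:\mathit{STam}\to\mathit{SMack}$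 sends $S$ to $(S^*,S_\bullet)$. For $M\in\mathit{SMack}$ let $\mathcal S_M(X)$ be the set of isomorphism classes of pairs $(A\xrightarrow{p}X,\,m)$ with $p$ in ${}_G\mathrm{Set}_{\mathcal C,\mathcal O_{\mathcal C}}$ and $m\in M(A)$, where a morphism $(A_1\xrightarrow{p_1}X,m_1)\to(A_2\xrightarrow{p_2}X,m_2)$ is an equivariant map $f:A_1\to A_2$ over $X$ with $M^*(f)(m_2)=m_1$. With the sum $(A_1\amalg A_2,\,m_1\amalg m_2)$, the product $(A_1\times_XA_2,\,M^*(\varpi_1)(m_1)\cdot M^*(\varpi_2)(m_2))$ ($\varpi_1,\varpi_2$ being the projections), and the structure morphisms $$\zeta^*(A,p,m)=(A\times_XY\to Y,\;M^*(\mathrm{pr}_A)(m)),\quad \xi_+(A,p,m)=(A,\xi\circ p,m),\quad \eta_\bullet(A,p,m)=(\Pi_\eta(A),\pi,M_*(\rho)M^*(\lambda)(m)),$$ $\mathcal S_M$ is a semi-Tambara functor, and $M\mapsto\mathcal S_M$ together with $\mathcal S_\varphi(A,p,m)=(A,p,\varphi_A(m))$ is a functor $\mathcal S:\mathit{SMack}\to\mathit{STam}$.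 Then, for every group $G$ and every Tambara system on $G$, the functor $\mathcal S:\mathit{SMack}\to\mathit{STam}$ is left adjoint to the forgetful functor $\mu:\mathit{STam}\to\mathit{SMack}$. -/

import Mathlib

open CategoryTheory MulAction
open scoped Pointwise

universe u

/-! ### Mackey systems and the category of `𝒞`-sets -/

/-- A Mackey system `(𝒞, 𝒪)` on `G`, with `𝒞` as a parameter. Only the values `O H` with
`H ∈ 𝒞` are meaningful. -/
structure MackeySystem {G : Type u} [Group G] (𝒞 : Set (Subgroup G)) where
  conj_mem : ∀ H ∈ 𝒞, ∀ g : G, MulAut.conj g • H ∈ 𝒞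
  inf_mem : ∀ H ∈ 𝒞, ∀ K ∈ 𝒞, H ⊓ K ∈ 𝒞
  O : Subgroup G → Set (Subgroup G)
  O_mem : ∀ H ∈ 𝒞, ∀ U ∈ O H, U ∈ 𝒞
  O_le : ∀ H ∈ 𝒞, ∀ U ∈ O H, U ≤ H
  finiteIndex : ∀ H ∈ 𝒞, ∀ U ∈ O H, (U.subgroupOf H).FiniteIndex
  O_trans : ∀ H ∈ 𝒞, ∀ U ∈ O H, O U ⊆ O H
  O_conj : ∀ H ∈ 𝒞, ∀ g : G, O (MulAut.conj g • H) = (fun U => MulAut.conj g • U) '' O H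
  O_inf : ∀ H ∈ 𝒞, ∀ U ∈ O H, ∀ V ∈ 𝒞, V ≤ H → U ⊓ V ∈ O V

/-- A `G`-set all of whose stabilizers belong to `𝒞`. -/
structure CSet {G : Type u} [Group G] (𝒞 : Set (Subgroup G)) where
  carrier : Type u
  [act : MulAction G carrier]
  stab_mem : ∀ x : carrier, stabilizer G x ∈ 𝒞

namespace CSet

variable {G : Type u} [Group G] {𝒞 : Set (Subgroup G)}

instance : CoeSort (CSet 𝒞) (Type u) := ⟨CSet.carrier⟩

attribute [instance] CSet.act

/-- The full subcategory of `G`-sets on the `𝒞`-sets: morphisms are equivariant maps. -/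
instance : Category (CSet 𝒞) where
  Hom X Y := X →[G] Y
  id _ := MulActionHom.id G
  comp f g := MulActionHom.comp g f

instance : ConcreteCategory (CSet 𝒞) (fun X Y => X →[G] Y) where
  hom f := f
  ofHom f := f

theorem map_smul' {X Y : CSet 𝒞} (f : X ⟶ Y) (g : G) (x : X) : f (g • x) = g • f x :=
  map_smul (ConcreteCategory.hom f) g x

/-- Constructor for morphisms. -/
def mkHom {X Y : CSet 𝒞} (f : X → Y) (h : ∀ (g : G) (x : X), f (g • x) = g • f x) : X ⟶ Y :=
  ({ toFun := f, map_smul' := h } : X →[G] Y)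

@[simp] theorem mkHom_apply {X Y : CSet 𝒞} (f : X → Y)
    (h : ∀ (g : G) (x : X), f (g • x) = g • f x) (x : X) : mkHom f h x = f x := rfl

theorem hom_ext' {X Y : CSet 𝒞} {f g : X ⟶ Y} (h : ∀ x, f x = g x) : f = g :=
  ConcreteCategory.hom_ext _ _ h

theorem stab_le {X Y : CSet 𝒞} (f : X ⟶ Y) (x : X) : stabilizer G x ≤ stabilizer G (f x) := by
  intro g hg
  rw [mem_stabilizer_iff] at hg ⊢
  rw [← map_smul', hg]

/-- A bijective equivariant map is an isomorphism. -/
noncomputable def isoOfBij {X Y : CSet 𝒞} (f : X ⟶ Y) (hf : Function.Bijective f) : X ≅ Y where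
  hom := f
  inv := mkHom (Equiv.ofBijective f hf).symm (fun g y => by
    apply hf.1
    rw [map_smul']
    have h : ∀ z, f ((Equiv.ofBijective f hf).symm z) = z :=
      (Equiv.ofBijective f hf).apply_symm_apply
    rw [h, h])
  hom_inv_id := hom_ext' fun x => (Equiv.ofBijective f hf).symm_apply_apply x
  inv_hom_id := hom_ext' fun x => (Equiv.ofBijective f hf).apply_symm_apply x

theorem bij_of_iso {X Y : CSet 𝒞} (e : X ≅ Y) : Function.Bijective e.hom := by
  refine Function.bijective_iff_has_inverse.2 ⟨e.inv, fun x => ?_, fun x => ?_⟩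
  · exact congrArg (fun f : X ⟶ X => f x) e.hom_inv_id
  · exact congrArg (fun f : Y ⟶ Y => f x) e.inv_hom_id

/-- `f` has finite fibers. -/
def FiniteFibers {X Y : CSet 𝒞} (f : X ⟶ Y) : Prop := ∀ y : Y, (f ⁻¹' {y}).Finite

end CSet

/-- The morphisms of the subcategory `𝒞_𝒪`: finite fibers and `G_x ∈ 𝒪 (G_{f x})`. -/
def MackeySystem.IsTransfer {G : Type u} [Group G] {𝒞 : Set (Subgroup G)} (𝓜 : MackeySystem 𝒞)
    {X Y : CSet 𝒞} (f : X ⟶ Y) : Prop :=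
  CSet.FiniteFibers f ∧ ∀ x : X, stabilizer G x ∈ 𝓜.O (stabilizer G (f x))

/-! ### Semi-Mackey functors -/

/-- The laws of a semi-Mackey functor on a Mackey system, for contravariant maps `res` and
covariant maps `tr` (apart from the requirement that these are monoid homomorphisms). In `mackey`
the fact that `g'` lies in `𝒞_𝒪` is automatic. -/
structure IsSemiMackey {G : Type u} [Group G] {𝒞 : Set (Subgroup G)} (𝓜 : MackeySystem 𝒞)
    (F : CSet 𝒞 → Type u)
    (res : ∀ {X Y : CSet 𝒞}, (X ⟶ Y) → F Y → F X)
    (tr : ∀ {X Y : CSet 𝒞} (f : X ⟶ Y), 𝓜.IsTransfer f → F X → F Y) : Prop where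
  res_id : ∀ (X : CSet 𝒞) (m : F X), res (𝟙 X) m = m
  res_comp : ∀ {X Y Z : CSet 𝒞} (f : X ⟶ Y) (g : Y ⟶ Z) (m : F Z),
    res (f ≫ g) m = res f (res g m)
  tr_id : ∀ (X : CSet 𝒞) (h : 𝓜.IsTransfer (𝟙 X)) (m : F X), tr (𝟙 X) h m = m
  tr_comp : ∀ {X Y Z : CSet 𝒞} (f : X ⟶ Y) (g : Y ⟶ Z) (hf : 𝓜.IsTransfer f)
    (hg : 𝓜.IsTransfer g) (hfg : 𝓜.IsTransfer (f ≫ g)) (m : F X),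
    tr (f ≫ g) hfg m = tr g hg (tr f hf m)
  mackey : ∀ {X' Y' X Y : CSet 𝒞} (f' : X' ⟶ X) (g' : X' ⟶ Y') (g : X ⟶ Y) (f : Y' ⟶ Y),
    IsPullback f' g' g f → ∀ (hg : 𝓜.IsTransfer g) (hg' : 𝓜.IsTransfer g') (m : F X),
      res f (tr g hg m) = tr g' hg' (res f' m)
  additive : ∀ {Λ : Type u} (X : CSet 𝒞) (Xl : Λ → CSet 𝒞) (i : ∀ l, Xl l ⟶ X),
    Function.Bijective (fun z : Σ l, Xl l => i z.1 z.2) →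
      Function.Bijective (fun (m : F X) (l : Λ) => res (i l) m)

/-- A semi-Mackey functor on `(𝒞, 𝒪)`. -/
structure SemiMackey {G : Type u} [Group G] {𝒞 : Set (Subgroup G)} (𝓜 : MackeySystem 𝒞) where
  obj : CSet 𝒞 → Type u
  [commMonoid : ∀ X, CommMonoid (obj X)]
  res : ∀ {X Y : CSet 𝒞}, (X ⟶ Y) → obj Y →* obj X
  tr : ∀ {X Y : CSet 𝒞} (f : X ⟶ Y), 𝓜.IsTransfer f → obj X →* obj Y
  laws : IsSemiMackey 𝓜 obj (fun f => res f) (fun f hf => tr f hf)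

attribute [instance] SemiMackey.commMonoid

namespace SemiMackey

variable {G : Type u} [Group G] {𝒞 : Set (Subgroup G)} {𝓜 : MackeySystem 𝒞}

/-- Morphisms of semi-Mackey functors. -/
@[ext] structure Hom (M N : SemiMackey 𝓜) where
  app : ∀ X : CSet 𝒞, M.obj X →* N.obj X
  res_comm : ∀ {X Y : CSet 𝒞} (f : X ⟶ Y) (m : M.obj Y), app X (M.res f m) = N.res f (app Y m)
  tr_comm : ∀ {X Y : CSet 𝒞} (f : X ⟶ Y) (hf : 𝓜.IsTransfer f) (m : M.obj X),
    app Y (M.tr f hf m) = N.tr f hf (app X m)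

instance : Category (SemiMackey 𝓜) where
  Hom := Hom
  id M := ⟨fun _ => MonoidHom.id _, fun _ _ => rfl, fun _ _ _ => rfl⟩
  comp φ ψ := ⟨fun X => (ψ.app X).comp (φ.app X),
    fun f m => by simp [φ.res_comm, ψ.res_comm],
    fun f hf m => by simp [φ.tr_comm, ψ.tr_comm]⟩

end SemiMackey

/-! ### Tambara systems -/

/-- A Tambara system on `G`: a set `subsets` of subsets of `G` closed under left and right
translation, finite intersections and finite unions, and a Mackey system on the set of all
subgroups belonging to it, such that `H ∈ 𝒪_• H` for all `H`. -/
structure TambaraSystem (G : Type u) [Group G] where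
  subsets : Set (Set G)
  left_mem : ∀ s ∈ subsets, ∀ g : G, (fun x => g * x) '' s ∈ subsets
  right_mem : ∀ s ∈ subsets, ∀ g : G, (fun x => x * g) '' s ∈ subsets
  inter_mem : ∀ s ∈ subsets, ∀ t ∈ subsets, s ∩ t ∈ subsets
  union_mem : ∀ s ∈ subsets, ∀ t ∈ subsets, s ∪ t ∈ subsets
  mul : MackeySystem {H : Subgroup G | (H : Set G) ∈ subsets}
  self_mem : ∀ H : Subgroup G, (H : Set G) ∈ subsets → H ∈ mul.O H

namespace TambaraSystem

variable {G : Type u} [Group G] (𝒯 : TambaraSystem G)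

/-- The set of subgroups of a Tambara system. -/
abbrev C : Set (Subgroup G) := {H : Subgroup G | (H : Set G) ∈ 𝒯.subsets}

theorem conj_mem (H : Subgroup G) (hH : H ∈ 𝒯.C) (g : G) : MulAut.conj g • H ∈ 𝒯.C := by
  have h := 𝒯.right_mem _ (𝒯.left_mem _ hH g) g⁻¹
  show ((MulAut.conj g • H : Subgroup G) : Set G) ∈ 𝒯.subsets
  convert h using 1
  ext x
  simp only [Subgroup.coe_pointwise_smul, Set.mem_smul_set, Set.mem_image, SetLike.mem_coe]
  constructor
  · rintro ⟨y, hy, rfl⟩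
    exact ⟨g * y, ⟨y, hy, rfl⟩, by simp⟩
  · rintro ⟨_, ⟨y, hy, rfl⟩, rfl⟩
    exact ⟨y, hy, by simp⟩

theorem inf_mem (H : Subgroup G) (hH : H ∈ 𝒯.C) (K : Subgroup G) (hK : K ∈ 𝒯.C) :
    H ⊓ K ∈ 𝒯.C := by
  show ((H ⊓ K : Subgroup G) : Set G) ∈ 𝒯.subsets
  rw [Subgroup.coe_inf]
  exact 𝒯.inter_mem _ hH _ hK

/-- The set `𝒪_𝒞 H` of all subgroups of `H` that belong to `𝒞` and have finite index in `H`. -/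
def natO (H : Subgroup G) : Set (Subgroup G) :=
  {U | U ∈ 𝒯.C ∧ U ≤ H ∧ (U.subgroupOf H).FiniteIndex}

theorem natO_conj (H : Subgroup G) (g : G) (U : Subgroup G) (hU : U ∈ 𝒯.natO H) :
    MulAut.conj g • U ∈ 𝒯.natO (MulAut.conj g • H) := by
  refine ⟨𝒯.conj_mem U hU.1 g, ?_, ⟨?_⟩⟩
  · exact Subgroup.pointwise_smul_le_pointwise_smul_iff.2 hU.2.1
  · have h := Subgroup.relIndex_pointwise_smul (MulAut.conj g) U H
    exact h.trans_ne hU.2.2.index_ne_zero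

/-- The Mackey system `(𝒞, 𝒪_𝒞)`. -/
def nat : MackeySystem 𝒯.C where
  conj_mem := 𝒯.conj_mem
  inf_mem := 𝒯.inf_mem
  O := 𝒯.natO
  O_mem _ _ _ hU := hU.1
  O_le _ _ _ hU := hU.2.1
  finiteIndex _ _ _ hU := hU.2.2
  O_trans H hH U hU V hV :=
    ⟨hV.1, hV.2.1.trans hU.2.1, ⟨Subgroup.relIndex_ne_zero_trans hV.2.2.1 hU.2.2.1⟩⟩
  O_conj H _ g := by
    ext U
    constructor
    · intro hU
      refine ⟨MulAut.conj g⁻¹ • U, ?_, ?_⟩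
      · have h := 𝒯.natO_conj _ g⁻¹ U hU
        rwa [← mul_smul, ← map_mul, inv_mul_cancel, map_one, one_smul] at h
      · show MulAut.conj g • MulAut.conj g⁻¹ • U = U
        rw [← mul_smul, ← map_mul, mul_inv_cancel, map_one, one_smul]
    · rintro ⟨V, hV, rfl⟩
      exact 𝒯.natO_conj H g V hV
  O_inf H hH U hU V hV hVH := by
    refine ⟨𝒯.inf_mem U hU.1 V hV, inf_le_right, ⟨?_⟩⟩
    show (U ⊓ V).relIndex V ≠ 0
    rw [Subgroup.inf_relIndex_right]
    exact fun h0 => hU.2.2.index_ne_zero (Subgroup.relIndex_eq_zero_of_le_right hVH h0)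

end TambaraSystem

/-! ### Exponential diagrams -/

namespace CSet

variable {G : Type u} [Group G]

section
variable {𝒞 : Set (Subgroup G)}

/-- An elementwise form of pull-back squares. -/
structure PB {P A B X : CSet 𝒞} (f' : P ⟶ A) (g' : P ⟶ B) (f : A ⟶ X) (g : B ⟶ X) : Prop where
  comm : ∀ z, f (f' z) = g (g' z)
  lift : ∀ a b, f a = g b → ∃ z, f' z = a ∧ g' z = b
  uniq : ∀ z z', f' z = f' z' → g' z = g' z' → z = z'

theorem FiniteFibers.comp {X Y Z : CSet 𝒞} {f : X ⟶ Y} {g : Y ⟶ Z} (hf : FiniteFibers f)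
    (hg : FiniteFibers g) : FiniteFibers (f ≫ g) := by
  intro z
  refine ((hg z).biUnion fun y _ => hf y).subset fun x hx => ?_
  simp only [Set.mem_iUnion]
  exact ⟨f x, hx, rfl⟩

theorem FiniteFibers.of_bij {X Y : CSet 𝒞} (f : X ⟶ Y) (hf : Function.Injective f) :
    FiniteFibers f := by
  intro y
  apply Set.Subsingleton.finite
  intro a ha b hb
  exact hf (ha.trans hb.symm)

theorem FiniteFibers.of_comp {X Y Z : CSet 𝒞} (f : X ⟶ Y) (g : Y ⟶ Z)
    (h : FiniteFibers (f ≫ g)) : FiniteFibers f := by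
  intro y
  refine (h (g y)).subset fun x hx => ?_
  exact congrArg g hx

theorem FiniteFibers.pb {P A B X : CSet 𝒞} {f' : P ⟶ A} {g' : P ⟶ B} {f : A ⟶ X} {g : B ⟶ X}
    (h : PB f' g' f g) (hf : FiniteFibers f) : FiniteFibers g' := by
  intro b
  refine Set.Finite.of_finite_image (f := f') (Set.Finite.subset (hf (g b)) ?_) ?_
  · rintro _ ⟨z, hz, rfl⟩
    exact (h.comm z).trans (congrArg g hz)
  · intro z hz z' hz' e
    exact h.uniq z z' e (hz.trans hz'.symm)

theorem PB.symm {P A B X : CSet 𝒞} {f' : P ⟶ A} {g' : P ⟶ B} {f : A ⟶ X} {g : B ⟶ X}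
    (h : PB f' g' f g) : PB g' f' g f :=
  ⟨fun z => (h.comm z).symm, fun a b e => (h.lift b a e.symm).imp fun _ h => h.symm,
    fun z z' e e' => h.uniq z z' e' e⟩

theorem PB.isPullback {P A B X : CSet 𝒞} {f' : P ⟶ A} {g' : P ⟶ B} {f : A ⟶ X} {g : B ⟶ X}
    (h : PB f' g' f g) : IsPullback f' g' f g := by
  have e : ∀ (s : Limits.PullbackCone f g) (t : s.pt), f (s.fst t) = g (s.snd t) := fun s t =>
    congrArg (fun k : s.pt ⟶ X => k t) s.condition
  have h1 := fun s t => (h.lift _ _ (e s t)).choose_spec.1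
  have h2 := fun s t => (h.lift _ _ (e s t)).choose_spec.2
  refine ⟨⟨hom_ext' h.comm⟩, ⟨Limits.PullbackCone.IsLimit.mk _
    (fun s => mkHom (fun t => (h.lift _ _ (e s t)).choose) fun k t => ?_)
    (fun s => hom_ext' (h1 s)) (fun s => hom_ext' (h2 s)) (fun s m h3 h4 => hom_ext' fun t => ?_)⟩⟩
  · apply h.uniq
    · rw [h1, map_smul', map_smul', h1]
    · rw [h2, map_smul', map_smul', h2]
  · refine h.uniq _ _ ?_ ?_
    · exact (congrArg (fun k : s.pt ⟶ A => k t) h3).trans (h1 s t).symm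
    · exact (congrArg (fun k : s.pt ⟶ B => k t) h4).trans (h2 s t).symm

theorem _root_.MackeySystem.IsTransfer.comp {𝓜 : MackeySystem 𝒞} {X Y Z : CSet 𝒞} {f : X ⟶ Y}
    {g : Y ⟶ Z} (hf : 𝓜.IsTransfer f) (hg : 𝓜.IsTransfer g) : 𝓜.IsTransfer (f ≫ g) :=
  ⟨hf.1.comp hg.1, fun x => 𝓜.O_trans _ ((g (f x) : Z) |> Z.stab_mem) _ (hg.2 (f x)) (hf.2 x)⟩

theorem PB.stab {P A B X : CSet 𝒞} {f' : P ⟶ A} {g' : P ⟶ B} {f : A ⟶ X} {g : B ⟶ X}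
    (h : PB f' g' f g) (z : P) :
    stabilizer G z = stabilizer G (f' z) ⊓ stabilizer G (g' z) := by
  refine le_antisymm (le_inf (stab_le f' z) (stab_le g' z)) fun k hk => ?_
  rw [Subgroup.mem_inf, mem_stabilizer_iff, mem_stabilizer_iff] at hk
  rw [mem_stabilizer_iff]
  exact h.uniq _ _ ((map_smul' _ _ _).trans hk.1) ((map_smul' _ _ _).trans hk.2)

theorem PB.isTransfer {𝓜 : MackeySystem 𝒞} {P A B X : CSet 𝒞} {f' : P ⟶ A} {g' : P ⟶ B}
    {f : A ⟶ X} {g : B ⟶ X} (h : PB f' g' f g) (hf : 𝓜.IsTransfer f) : 𝓜.IsTransfer g' := by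
  refine ⟨hf.1.pb h, fun z => ?_⟩
  rw [h.stab]
  refine 𝓜.O_inf _ (X.stab_mem (f (f' z))) _ (hf.2 _) _ (B.stab_mem _) ?_
  rw [h.comm]
  exact stab_le g _

end

variable {𝒯 : TambaraSystem G}

/-- For `𝒯.nat`, the transfer morphisms are the morphisms with finite fibers. -/
theorem nat_isTransfer {X Y : CSet 𝒯.C} {f : X ⟶ Y} (hf : FiniteFibers f) :
    𝒯.nat.IsTransfer f := by
  refine ⟨hf, fun x => ⟨X.stab_mem x, stab_le f x, ⟨?_⟩⟩⟩
  have h : (stabilizer G x).subgroupOf (stabilizer G (f x))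
      = stabilizer (stabilizer G (f x)) x := by
    ext k
    rw [Subgroup.mem_subgroupOf, mem_stabilizer_iff, mem_stabilizer_iff]
    rfl
  rw [h, index_stabilizer]
  have hfin : (orbit (stabilizer G (f x)) x).Finite := by
    refine (hf (f x)).subset ?_
    rintro _ ⟨k, rfl⟩
    show f ((k : G) • x) = f x
    rw [map_smul']
    exact k.2
  exact fun h0 => (Set.ncard_pos hfin).2 (nonempty_orbit x) |>.ne' h0

/-- The fibered product `A ×_X B`. -/
def pb {A B X : CSet 𝒯.C} (f : A ⟶ X) (g : B ⟶ X) : CSet 𝒯.C :=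
  letI : MulAction G {z : A × B // f z.1 = g z.2} :=
    { smul := fun k z => ⟨k • z.1, by
        show f (k • z.1.1) = g (k • z.1.2)
        rw [map_smul', map_smul', z.2]⟩
      one_smul := fun z => Subtype.ext (one_smul G z.1)
      mul_smul := fun k l z => Subtype.ext (mul_smul k l z.1) }
  { carrier := {z : A × B // f z.1 = g z.2}
    stab_mem := fun z => by
      have h : stabilizer G z = stabilizer G z.1.1 ⊓ stabilizer G z.1.2 := by
        ext k
        simp only [Subgroup.mem_inf, mem_stabilizer_iff]
        exact Subtype.ext_iff.trans Prod.ext_iff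
      rw [h]
      exact 𝒯.inf_mem _ (A.stab_mem _) _ (B.stab_mem _) }

/-- The projections of `A ×_X B`. -/
def fst {A B X : CSet 𝒯.C} (f : A ⟶ X) (g : B ⟶ X) : pb f g ⟶ A :=
  mkHom (fun z => z.1.1) fun _ _ => rfl

/-- The projections of `A ×_X B`. -/
def snd {A B X : CSet 𝒯.C} (f : A ⟶ X) (g : B ⟶ X) : pb f g ⟶ B :=
  mkHom (fun z => z.1.2) fun _ _ => rfl

theorem pb_PB {A B X : CSet 𝒯.C} (f : A ⟶ X) (g : B ⟶ X) : PB (fst f g) (snd f g) f g :=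
  ⟨fun z => z.2, fun a b h => ⟨⟨(a, b), h⟩, rfl, rfl⟩,
    fun _ _ h h' => Subtype.ext (Prod.ext h h')⟩

theorem PB.of_isPullback {P A B X : CSet 𝒯.C} {f' : P ⟶ A} {g' : P ⟶ B} {f : A ⟶ X} {g : B ⟶ X}
    (h : IsPullback f' g' f g) : PB f' g' f g := by
  let e := h.isoIsPullback _ _ (pb_PB f g).isPullback
  have e1 : ∀ z, fst f g (e.hom z) = f' z := fun z =>
    congrArg (fun k : P ⟶ A => k z) (h.isoIsPullback_hom_fst _ _ (pb_PB f g).isPullback)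
  have e2 : ∀ z, snd f g (e.hom z) = g' z := fun z =>
    congrArg (fun k : P ⟶ B => k z) (h.isoIsPullback_hom_snd _ _ (pb_PB f g).isPullback)
  have hb := bij_of_iso e
  refine ⟨fun z => ?_, fun a b hab => ?_, fun z z' h1 h2 => ?_⟩
  · rw [← e1, ← e2, (pb_PB f g).comm]
  · obtain ⟨w, h1, h2⟩ := (pb_PB f g).lift a b hab
    obtain ⟨z, rfl⟩ := hb.2 w
    exact ⟨z, (e1 z).symm.trans h1, (e2 z).symm.trans h2⟩
  · apply hb.1
    apply (pb_PB f g).uniq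
    · rw [e1, e1, h1]
    · rw [e2, e2, h2]

/-- A point `(y, σ)` of `Π_η(A)`: a point `y` and a section `σ` of `p` over `η⁻¹(y)`. -/
structure PiPt {A X Y : CSet 𝒯.C} (η : X ⟶ Y) (p : A ⟶ X) where
  pt : Y
  sec : {x : X // η x = pt} → A
  sec_spec : ∀ x, p (sec x) = x.1

namespace PiPt

variable {A X Y : CSet 𝒯.C} {η : X ⟶ Y} {p : A ⟶ X}

theorem ext' {s t : PiPt η p} (h : s.pt = t.pt)
    (h' : ∀ x hx hx', s.sec ⟨x, hx⟩ = t.sec ⟨x, hx'⟩) : s = t := by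
  obtain ⟨y, σ, hσ⟩ := s
  obtain ⟨y', τ, hτ⟩ := t
  obtain rfl : y = y' := h
  obtain rfl : σ = τ := funext fun x => h' x.1 x.2 x.2
  rfl

theorem sec_congr (s : PiPt η p) {x x' : X} (h : x = x') (hx : η x = s.pt) (hx' : η x' = s.pt) :
    s.sec ⟨x, hx⟩ = s.sec ⟨x', hx'⟩ := by
  subst h
  rfl

theorem inv_aux (g : G) {x : X} {y : Y} (h : η x = g • y) : η (g⁻¹ • x) = y := by
  rw [map_smul', h, inv_smul_smul]

/-- The action `g (y, σ) = (g y, x ↦ g σ(g⁻¹ x))`. -/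
instance : MulAction G (PiPt η p) where
  smul g s :=
    { pt := g • s.pt
      sec := fun x => g • s.sec ⟨g⁻¹ • x.1, inv_aux g x.2⟩
      sec_spec := fun x => by rw [map_smul', s.sec_spec, smul_inv_smul] }
  one_smul s := ext' (one_smul G s.pt) fun x hx hx' =>
    (one_smul G _).trans (s.sec_congr (by rw [inv_one, one_smul]) _ _)
  mul_smul g h s := ext' (mul_smul g h s.pt) fun x hx hx' => by
    refine (mul_smul g h _).trans (congrArg (g • ·) (congrArg (h • ·) (s.sec_congr ?_ _ _)))
    rw [mul_inv_rev, mul_smul]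

theorem smul_pt (g : G) (s : PiPt η p) : (g • s).pt = g • s.pt := rfl

theorem smul_sec (g : G) (s : PiPt η p) (x : X) (hx : η x = s.pt) (hx' : η (g • x) = (g • s).pt) :
    (g • s).sec ⟨g • x, hx'⟩ = g • s.sec ⟨x, hx⟩ :=
  congrArg (g • ·) (s.sec_congr (inv_smul_smul g x) _ _)

theorem mem_stab {g : G} {s : PiPt η p} : g ∈ stabilizer G s ↔ g ∈ stabilizer G s.pt ∧
    ∀ x hx, ∃ x', ∃ hx', g • s.sec ⟨x, hx⟩ = s.sec ⟨x', hx'⟩ := by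
  simp only [mem_stabilizer_iff]
  constructor
  · intro h
    have h1 : g • s.pt = s.pt := congrArg PiPt.pt h
    refine ⟨h1, fun x hx => ?_⟩
    have hx2 : η (g • x) = s.pt := by rw [map_smul', hx, h1]
    refine ⟨g • x, hx2, ?_⟩
    rw [← smul_sec g s x hx (by rw [map_smul', hx]; rfl)]
    have key : ∀ t : PiPt η p, t = s → ∀ x hx hx', t.sec ⟨x, hx⟩ = s.sec ⟨x, hx'⟩ := by
      rintro t rfl x hx hx'
      rfl
    exact key _ h _ _ _
  · rintro ⟨h1, h2⟩
    refine ext' h1 fun x hx hx' => ?_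
    have hx3 : η (g⁻¹ • x) = s.pt := inv_aux g hx
    obtain ⟨x', hx4, e⟩ := h2 (g⁻¹ • x) hx3
    refine Eq.trans e (s.sec_congr ?_ _ _)
    have := congrArg p e
    rw [map_smul', s.sec_spec, s.sec_spec, smul_inv_smul] at this
    exact this.symm

end PiPt

theorem union_aux {ι : Type u} (F : Set ι) (hF : F.Finite) (V : ι → Set G)
    (hV : ∀ i ∈ F, V i = ∅ ∨ V i ∈ 𝒯.subsets) :
    (⋃ i ∈ F, V i) = ∅ ∨ (⋃ i ∈ F, V i) ∈ 𝒯.subsets := by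
  induction F, hF using Set.Finite.induction_on with
  | empty => left; simp
  | @insert a s ha hs ih =>
    rw [Set.biUnion_insert]
    rcases ih fun i hi => hV i (Or.inr hi) with h | h <;> rcases hV a (Or.inl rfl) with h' | h'
    · left; simp [h, h']
    · right; simpa [h] using h'
    · right; simpa [h'] using h
    · right; exact 𝒯.union_mem _ h' _ h

theorem inter_aux {ι : Type u} (F : Set ι) (hF : F.Finite) (H : Set G) (hH : H ∈ 𝒯.subsets)
    (V : ι → Set G) (hV : ∀ i ∈ F, V i ∈ 𝒯.subsets) :
    (H ∩ ⋂ i ∈ F, V i) ∈ 𝒯.subsets := by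
  induction F, hF using Set.Finite.induction_on with
  | empty => simpa using hH
  | @insert a s ha hs ih =>
    rw [Set.biInter_insert, Set.inter_left_comm]
    exact 𝒯.inter_mem _ (hV a (Or.inl rfl)) _ (ih fun i hi => hV i (Or.inr hi))

theorem translate_mem (A : CSet 𝒯.C) (a b : A) :
    {g : G | g • a = b} = ∅ ∨ {g : G | g • a = b} ∈ 𝒯.subsets := by
  rcases Set.eq_empty_or_nonempty {g : G | g • a = b} with h | ⟨g₀, rfl⟩
  · exact Or.inl h
  · right
    convert 𝒯.left_mem _ (A.stab_mem a) g₀ using 1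
    ext g
    simp only [Set.mem_ofPred_eq, Set.mem_image, SetLike.mem_coe, mem_stabilizer_iff]
    constructor
    · intro h
      exact ⟨g₀⁻¹ * g, by rw [mul_smul, h, inv_smul_smul], by simp⟩
    · rintro ⟨k, hk, rfl⟩
      rw [mul_smul, hk]

/-- The `G`-set `Π_η(A)`, for `η` with finite fibers. -/
def pi {A X Y : CSet 𝒯.C} (η : X ⟶ Y) (hη : FiniteFibers η) (p : A ⟶ X) : CSet 𝒯.C where
  carrier := PiPt η p
  stab_mem s := by
    have hfin : (Set.univ : Set {x : X // η x = s.pt}).Finite :=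
      @Set.finite_univ _ (Set.Finite.to_subtype (hη s.pt))
    have hset : ((stabilizer G s : Subgroup G) : Set G) = (stabilizer G s.pt : Set G) ∩
        ⋂ x ∈ (Set.univ : Set {x : X // η x = s.pt}),
          ⋃ x' ∈ (Set.univ : Set {x : X // η x = s.pt}), {g : G | g • s.sec x = s.sec x'} := by
      ext g
      simp only [SetLike.mem_coe, PiPt.mem_stab, Set.mem_inter_iff, Set.mem_iInter, Set.mem_univ,
        Set.mem_iUnion, Set.mem_ofPred_eq, Subtype.forall, Subtype.exists, true_implies,
        exists_const]
    show ((stabilizer G s : Subgroup G) : Set G) ∈ 𝒯.subsets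
    rw [hset]
    refine inter_aux _ hfin _ (Y.stab_mem _) _ fun x _ => ?_
    refine (union_aux _ hfin _ fun x' _ => translate_mem A _ _).resolve_left ?_
    refine Set.Nonempty.ne_empty ⟨1, ?_⟩
    simp only [Set.mem_iUnion]
    exact ⟨x, trivial, one_smul G _⟩

/-- The projection `π : Π_η(A) → Y`. -/
def piProj {A X Y : CSet 𝒯.C} (η : X ⟶ Y) (hη : FiniteFibers η) (p : A ⟶ X) : pi η hη p ⟶ Y :=
  mkHom (fun s => s.pt) fun _ _ => rfl

/-- The evaluation `λ : X ×_Y Π_η(A) → A`, `(x, (y, σ)) ↦ σ(x)`. -/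
def piEval {A X Y : CSet 𝒯.C} (η : X ⟶ Y) (hη : FiniteFibers η) (p : A ⟶ X) :
    pb η (piProj η hη p) ⟶ A :=
  mkHom (fun z => z.1.2.sec ⟨z.1.1, z.2⟩) fun g z => PiPt.smul_sec g z.1.2 z.1.1 z.2 _

/-- A diagram `X ←ξ- Z ←ζ- X' -η'→ Y' -υ→ Y` over `η : X → Y` is an exponential diagram if it is
isomorphic to the diagram `X ←p- A ←λ- X ×_Y Π_η(A) -ρ→ Π_η(A) -π→ Y` for some `p : A → X` with
finite fibers. -/
def IsExponential {X Y Z X' Y' : CSet 𝒯.C} (η : X ⟶ Y) (ξ : Z ⟶ X) (ζ : X' ⟶ Z) (η' : X' ⟶ Y')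
    (υ : Y' ⟶ Y) : Prop :=
  ∃ (A : CSet 𝒯.C) (p : A ⟶ X) (_ : 𝒯.nat.IsTransfer p) (hη : 𝒯.mul.IsTransfer η)
    (eZ : Z ≅ A) (eX' : X' ≅ pb η (piProj η hη.1 p)) (eY' : Y' ≅ pi η hη.1 p),
    eZ.hom ≫ p = ξ ∧ ζ ≫ eZ.hom = eX'.hom ≫ piEval η hη.1 p ∧
      η' ≫ eY'.hom = eX'.hom ≫ snd η (piProj η hη.1 p) ∧ eY'.hom ≫ piProj η hη.1 p = υ

end CSet

/-! ### Semi-Tambara functors -/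

/-- A semi-Tambara functor on a Tambara system. In `exponential` the facts that `ξ`, `υ` have
finite fibers and that `η'` lies in `𝒞_{𝒪_•}` are automatic. -/
structure SemiTambara {G : Type u} [Group G] (𝒯 : TambaraSystem G) where
  obj : CSet 𝒯.C → Type u
  [commSemiring : ∀ X, CommSemiring (obj X)]
  res : ∀ {X Y : CSet 𝒯.C}, (X ⟶ Y) → obj Y →+* obj X
  trAdd : ∀ {X Y : CSet 𝒯.C} (f : X ⟶ Y), 𝒯.nat.IsTransfer f → obj X →+ obj Y
  trMul : ∀ {X Y : CSet 𝒯.C} (f : X ⟶ Y), 𝒯.mul.IsTransfer f → obj X →* obj Y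
  addLaws : IsSemiMackey 𝒯.nat obj (fun f => res f) (fun f hf => trAdd f hf)
  mulLaws : IsSemiMackey 𝒯.mul obj (fun f => res f) (fun f hf => trMul f hf)
  exponential : ∀ {X Y Z X' Y' : CSet 𝒯.C} (η : X ⟶ Y) (ξ : Z ⟶ X) (ζ : X' ⟶ Z) (η' : X' ⟶ Y')
    (υ : Y' ⟶ Y), CSet.IsExponential η ξ ζ η' υ →
    ∀ (hη : 𝒯.mul.IsTransfer η) (hξ : 𝒯.nat.IsTransfer ξ) (hη' : 𝒯.mul.IsTransfer η')
      (hυ : 𝒯.nat.IsTransfer υ) (s : obj Z),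
      trAdd υ hυ (trMul η' hη' (res ζ s)) = trMul η hη (trAdd ξ hξ s)

attribute [instance] SemiTambara.commSemiring

namespace SemiTambara

variable {G : Type u} [Group G] {𝒯 : TambaraSystem G}

/-- Morphisms of semi-Tambara functors. -/
@[ext] structure Hom (S T : SemiTambara 𝒯) where
  app : ∀ X : CSet 𝒯.C, S.obj X →+* T.obj X
  res_comm : ∀ {X Y : CSet 𝒯.C} (f : X ⟶ Y) (s : S.obj Y), app X (S.res f s) = T.res f (app Y s)
  trAdd_comm : ∀ {X Y : CSet 𝒯.C} (f : X ⟶ Y) (hf : 𝒯.nat.IsTransfer f) (s : S.obj X),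
    app Y (S.trAdd f hf s) = T.trAdd f hf (app X s)
  trMul_comm : ∀ {X Y : CSet 𝒯.C} (f : X ⟶ Y) (hf : 𝒯.mul.IsTransfer f) (s : S.obj X),
    app Y (S.trMul f hf s) = T.trMul f hf (app X s)

instance : Category (SemiTambara 𝒯) where
  Hom := Hom
  id S := ⟨fun _ => RingHom.id _, fun _ _ => rfl, fun _ _ _ => rfl, fun _ _ _ => rfl⟩
  comp φ ψ := ⟨fun X => (ψ.app X).comp (φ.app X),
    fun f s => by simp [φ.res_comm, ψ.res_comm],
    fun f hf s => by simp [φ.trAdd_comm, ψ.trAdd_comm],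
    fun f hf s => by simp [φ.trMul_comm, ψ.trMul_comm]⟩

/-- The forgetful functor `μ`, which sends `S` to its multiplicative part `(S^*, S_•)`. -/
def forgetMul (𝒯 : TambaraSystem G) : SemiTambara 𝒯 ⥤ SemiMackey 𝒯.mul where
  obj S :=
    { obj := S.obj
      res := fun f => (S.res f : S.obj _ →* S.obj _)
      tr := fun f hf => S.trMul f hf
      laws := S.mulLaws }
  map ψ := ⟨fun X => (ψ.app X : _ →* _), fun f s => ψ.res_comm f s, fun f hf s => ψ.trMul_comm f hf s⟩
  map_id _ := rfl
  map_comp _ _ := rfl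

end SemiTambara

/-! ### The Tambarization of a semi-Mackey functor -/

namespace CSet

variable {G : Type u} [Group G] {𝒯 : TambaraSystem G}

/-- The empty `𝒞`-set. -/
def empty (𝒯 : TambaraSystem G) : CSet 𝒯.C :=
  letI : MulAction G PEmpty.{u + 1} :=
    { smul := fun _ x => x, one_smul := fun x => x.elim, mul_smul := fun _ _ x => x.elim }
  { carrier := PEmpty.{u + 1}, stab_mem := fun x => x.elim }

/-- The map from the empty `𝒞`-set. -/
def fromEmpty (X : CSet 𝒯.C) : empty 𝒯 ⟶ X :=
  mkHom (fun x : PEmpty.{u + 1} => x.elim) fun _ (x : PEmpty.{u + 1}) => x.elim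

/-- Disjoint unions. -/
def sigma {Λ : Type u} (A : Λ → CSet 𝒯.C) : CSet 𝒯.C where
  carrier := Σ l, A l
  stab_mem := by
    rintro ⟨l, x⟩
    have h : stabilizer G (⟨l, x⟩ : Σ l, A l) = stabilizer G x := by
      ext g
      simp [mem_stabilizer_iff, Sigma.smul_mk]
    rw [h]
    exact (A l).stab_mem x

/-- The sum `A ⨿ B`. -/
def sum (A B : CSet 𝒯.C) : CSet 𝒯.C where
  carrier := A ⊕ B
  stab_mem := by
    rintro (x | x)
    · have h : stabilizer G (Sum.inl x : A ⊕ B) = stabilizer G x := by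
        ext g
        simp [mem_stabilizer_iff, Sum.smul_inl]
      rw [h]
      exact A.stab_mem x
    · have h : stabilizer G (Sum.inr x : A ⊕ B) = stabilizer G x := by
        ext g
        simp [mem_stabilizer_iff, Sum.smul_inr]
      rw [h]
      exact B.stab_mem x

/-- The inclusion of the left summand. -/
def inl (A B : CSet 𝒯.C) : A ⟶ sum A B := mkHom Sum.inl fun _ _ => rfl

/-- The inclusion of the right summand. -/
def inr (A B : CSet 𝒯.C) : B ⟶ sum A B := mkHom Sum.inr fun _ _ => rfl

/-- The morphism `p ∪ q` on a sum. -/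
def elim {A B X : CSet 𝒯.C} (p : A ⟶ X) (q : B ⟶ X) : sum A B ⟶ X :=
  mkHom (Sum.elim p q) (by rintro g (x | x) <;> exact map_smul' _ _ _)

theorem sum_bij (A B : CSet 𝒯.C) : Function.Bijective (Sum.elim (inl A B) (inr A B)) := by
  constructor
  · rintro (x | x) (y | y) h
    · exact h
    · exact h
    · exact h
    · exact h
  · rintro (x | x)
    · exact ⟨Sum.inl x, rfl⟩
    · exact ⟨Sum.inr x, rfl⟩

theorem FiniteFibers.elim {A B X : CSet 𝒯.C} {p : A ⟶ X} {q : B ⟶ X} (hp : FiniteFibers p)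
    (hq : FiniteFibers q) : FiniteFibers (elim p q) := by
  intro x
  refine (((hp x).image Sum.inl).union ((hq x).image Sum.inr)).subset ?_
  rintro (z | z) hz
  · exact Or.inl ⟨z, hz, rfl⟩
  · exact Or.inr ⟨z, hz, rfl⟩

theorem FiniteFibers.fromEmpty (X : CSet 𝒯.C) : FiniteFibers (fromEmpty X) :=
  FiniteFibers.of_bij _ fun x => PEmpty.elim x

theorem FiniteFibers.id (X : CSet 𝒯.C) : FiniteFibers (𝟙 X) :=
  FiniteFibers.of_bij _ fun _ _ h => h

theorem FiniteFibers.piProj {A X Y : CSet 𝒯.C} {η : X ⟶ Y} (hη : FiniteFibers η) {p : A ⟶ X}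
    (hp : FiniteFibers p) : FiniteFibers (piProj η hη p) := by
  intro y
  have := (hη y).to_subtype
  have : ∀ x : (η ⁻¹' {y} : Set X), Finite (p ⁻¹' {x.1} : Set A) := fun x => (hp x.1).to_subtype
  have key : ∀ s : PiPt η p, s.pt = y → ∀ x : (η ⁻¹' {y} : Set X), η x.1 = s.pt :=
    fun s hs x => (show η x.1 = y from x.2).trans hs.symm
  let F : (CSet.piProj η hη p ⁻¹' {y} : Set (pi η hη p)) →
      ∀ x : (η ⁻¹' {y} : Set X), (p ⁻¹' {x.1} : Set A) :=
    fun s x => ⟨PiPt.sec s.1 ⟨x.1, key s.1 s.2 x⟩, PiPt.sec_spec s.1 _⟩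
  refine Set.finite_coe_iff.1 (Finite.of_injective F ?_)
  rintro ⟨s, hs⟩ ⟨t, ht⟩ h
  refine Subtype.ext (PiPt.ext' (Eq.trans hs (Eq.symm ht)) fun x hx hx' => ?_)
  exact congrArg Subtype.val (congrFun h ⟨x, hx.trans hs⟩)

/-- An elementwise form of exponential diagrams. -/
structure IsExp {A X Y X' Y' : CSet 𝒯.C} (η : X ⟶ Y) (p : A ⟶ X) (l : X' ⟶ A) (r : X' ⟶ Y')
    (π : Y' ⟶ Y) : Prop where
  pbk : PB (l ≫ p) r η π
  sec : ∀ (y : Y) (σ : ∀ x : X, η x = y → A), (∀ x h, p (σ x h) = x) →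
    ∃ y', π y' = y ∧ ∀ x', r x' = y' → ∀ h, l x' = σ (p (l x')) h
  uniq : ∀ y' y'', π y' = π y'' →
    (∀ x' x'', r x' = y' → r x'' = y'' → p (l x') = p (l x'') → l x' = l x'') → y' = y''

theorem isExp_pi {A X Y : CSet 𝒯.C} (η : X ⟶ Y) (hη : FiniteFibers η) (p : A ⟶ X) :
    IsExp η p (piEval η hη p) (snd η (piProj η hη p)) (piProj η hη p) := by
  have hsp : ∀ z, p (piEval η hη p z) = fst η (piProj η hη p) z := fun z =>
    PiPt.sec_spec z.1.2 _
  have h0 : piEval η hη p ≫ p = fst η (piProj η hη p) := hom_ext' hsp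
  refine ⟨h0 ▸ pb_PB _ _, fun y σ hσ => ?_, fun s t hst h => ?_⟩
  · refine ⟨(⟨y, fun x => σ x.1 x.2, fun x => hσ _ _⟩ : PiPt η p), rfl, ?_⟩
    rintro ⟨⟨x, s⟩, hx⟩ rfl h
    have : ∀ x' (e : x' = x) (h : η x' = y), σ x hx = σ x' h := by
      rintro x' rfl h
      rfl
    exact this _ (hsp _) h
  · refine PiPt.ext' hst fun x hx hx' => ?_
    refine h ⟨(x, s), hx⟩ ⟨(x, t), hx'⟩ rfl rfl ?_
    exact (hsp ⟨(x, s), hx⟩).trans (hsp ⟨(x, t), hx'⟩).symm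

theorem IsExp.trans_iso {A B X Y X' Y' : CSet 𝒯.C} {η : X ⟶ Y} {p : A ⟶ X} {l : X' ⟶ A}
    {r : X' ⟶ Y'} {π : Y' ⟶ Y} (h : IsExp η p l r π) (q : B ⟶ X) (e : A ⟶ B)
    (he : Function.Bijective e) (w : ∀ x, q (e x) = p x) : IsExp η q (l ≫ e) r π := by
  have h0 : (l ≫ e) ≫ q = l ≫ p := hom_ext' fun x => w (l x)
  have w' : ∀ x, q ((l ≫ e) x) = p (l x) := fun x => w (l x)
  refine ⟨h0 ▸ h.pbk, fun y σ hσ => ?_, fun y' y'' h1 h2 => h.uniq _ _ h1 fun x' x'' a b c => ?_⟩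
  · choose τ hτ using fun x hx => he.2 (σ x hx)
    obtain ⟨y', h1, h2⟩ := h.sec y τ (fun x hx => by rw [← w, hτ, hσ])
    refine ⟨y', h1, fun x' hx' => ?_⟩
    rw [w']
    intro hh
    exact (congrArg e (h2 x' hx' hh)).trans (hτ _ _)
  · exact he.1 (h2 x' x'' a b (by rw [w', w', c]))

/-- An exponential diagram is isomorphic to the canonical one. -/
theorem IsExp.exists_iso {A X Y X' Y' : CSet 𝒯.C} {η : X ⟶ Y} {p : A ⟶ X} {l : X' ⟶ A}
    {r : X' ⟶ Y'} {π : Y' ⟶ Y} (h : IsExp η p l r π) (hη : FiniteFibers η) :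
    ∃ (E : Y' ⟶ pi η hη p) (E' : X' ⟶ pb η (piProj η hη p)), Function.Bijective E ∧
      (∀ y, piProj η hη p (E y) = π y) ∧ E' ≫ piEval η hη p = l ∧
      PB E' r (snd η (piProj η hη p)) E := by
  choose k hk1 hk2 using h.pbk.lift
  have hk : ∀ x y hxy z, p (l z) = x → r z = y → k x y hxy = z := fun x y hxy z h1 h2 =>
    h.pbk.uniq _ _ ((hk1 x y hxy).trans h1.symm) ((hk2 x y hxy).trans h2.symm)
  have hk1' : ∀ x y hxy, p (l (k x y hxy)) = x := hk1
  let F : Y' → PiPt η p := fun y => ⟨π y, fun x => l (k x.1 y x.2), fun x => hk1 _ _ _⟩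
  have hF : ∀ (g : G) (y : Y'), F (g • y) = g • F y := fun g y => by
    refine PiPt.ext' (map_smul' _ _ _) fun x hx hx' => ?_
    show l (k x (g • y) hx) = g • l (k (g⁻¹ • x) y _)
    rw [← map_smul']
    refine congrArg l (hk _ _ _ _ ?_ ?_)
    · rw [map_smul', map_smul', hk1', smul_inv_smul]
    · rw [map_smul', hk2]
  let E : Y' ⟶ pi η hη p := mkHom F hF
  let E' : X' ⟶ pb η (piProj η hη p) := mkHom (fun z => ⟨(p (l z), E (r z)), h.pbk.comm z⟩)
    fun g z => Subtype.ext (Prod.ext (by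
      show p (l (g • z)) = g • p (l z)
      rw [map_smul', map_smul']) (by
      show E (r (g • z)) = g • E (r z)
      rw [map_smul', map_smul']))
  have hE' : E' ≫ piEval η hη p = l := hom_ext' fun z => congrArg l (hk _ _ _ z rfl rfl)
  refine ⟨E, E', ⟨fun y y' e => ?_, fun s => ?_⟩, fun y => rfl, hE', fun z => rfl, ?_, ?_⟩
  · refine h.uniq _ _ (congrArg PiPt.pt e) fun x x' h1 h2 h3 => ?_
    have key : ∀ s t : PiPt η p, s = t → ∀ x hx hx', s.sec ⟨x, hx⟩ = t.sec ⟨x, hx'⟩ := by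
      rintro t _ rfl x hx hx'
      rfl
    have hx : η (p (l x)) = π y := (h.pbk.comm x).trans (congrArg π h1)
    have hx' : η (p (l x)) = π y' := by
      rw [h3]
      exact (h.pbk.comm x').trans (congrArg π h2)
    have := key (F y) (F y') e (p (l x)) hx hx'
    refine Eq.trans (congrArg l (hk _ _ hx x rfl h1).symm) (this.trans ?_)
    exact congrArg l (hk _ _ hx' x' h3.symm h2)
  · obtain ⟨y, h1, h2⟩ := h.sec s.pt (fun x hx => s.sec ⟨x, hx⟩) fun x hx => s.sec_spec _
    refine ⟨y, PiPt.ext' h1 fun x hx hx' => ?_⟩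
    have h3 : p (l (k x y hx)) = x := hk1' _ _ _
    refine (h2 (k x y hx) (hk2 _ _ _) (by rw [h3]; exact hx')).trans (s.sec_congr h3 _ _)
  · rintro ⟨⟨x, s⟩, hx⟩ y hs
    obtain rfl : s = E y := hs
    refine ⟨k x y hx, Subtype.ext (Prod.ext (hk1' _ _ _) ?_), hk2 _ _ _⟩
    exact congrArg E (hk2 x y hx)
  · intro z z' h1 h2
    exact h.pbk.uniq _ _ (congrArg (fun w => w.1.1) h1) h2

theorem IsExp.finite {A X Y X' Y' : CSet 𝒯.C} {η : X ⟶ Y} {p : A ⟶ X} {l : X' ⟶ A}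
    {r : X' ⟶ Y'} {π : Y' ⟶ Y} (h : IsExp η p l r π) (hη : FiniteFibers η)
    (hp : FiniteFibers p) : FiniteFibers π := by
  obtain ⟨E, _, hE, hπ, -⟩ := h.exists_iso hη
  rw [show π = E ≫ piProj η hη p from hom_ext' fun y => (hπ y).symm]
  exact (FiniteFibers.of_bij _ hE.1).comp (FiniteFibers.piProj hη hp)

theorem IsExponential.isExp {X Y Z X' Y' : CSet 𝒯.C} {η : X ⟶ Y} {ξ : Z ⟶ X} {ζ : X' ⟶ Z}
    {η' : X' ⟶ Y'} {υ : Y' ⟶ Y} (h : IsExponential η ξ ζ η' υ) : IsExp η ξ ζ η' υ := by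
  obtain ⟨A, p, -, hη, eZ, eX, eY, h1, h2, h3, h4⟩ := h
  have h0 := isExp_pi η hη.1 p
  have bZ := bij_of_iso eZ
  have bX := bij_of_iso eX
  have bY := bij_of_iso eY
  have h1' : ∀ z, p (eZ.hom z) = ξ z := fun z => congrArg (fun k : Z ⟶ X => k z) h1
  have h2' : ∀ z, eZ.hom (ζ z) = piEval η hη.1 p (eX.hom z) := fun z =>
    congrArg (fun k : X' ⟶ A => k z) h2
  have h3' : ∀ z, eY.hom (η' z) = snd _ _ (eX.hom z) := fun z =>
    congrArg (fun k : X' ⟶ _ => k z) h3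
  have h4' : ∀ z, piProj η hη.1 p (eY.hom z) = υ z := fun z =>
    congrArg (fun k : Y' ⟶ Y => k z) h4
  have hp : ∀ z, ξ (ζ z) = p (piEval η hη.1 p (eX.hom z)) := fun z => by rw [← h1', h2']
  refine ⟨⟨fun z => ?_, fun x y e => ?_, fun z z' e e' => ?_⟩, fun y σ hσ => ?_,
    fun y y' e h => ?_⟩
  · refine (congrArg η (hp z)).trans ((h0.pbk.comm _).trans ?_)
    rw [← h3', h4']
  · obtain ⟨w, hw1, hw2⟩ := h0.pbk.lift x (eY.hom y) (e.trans (h4' y).symm)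
    obtain ⟨z, rfl⟩ := bX.2 w
    exact ⟨z, (hp z).trans hw1, bY.1 ((h3' z).trans hw2)⟩
  · refine bX.1 (h0.pbk.uniq _ _ ?_ ?_)
    · exact (hp z).symm.trans (e.trans (hp z'))
    · rw [← h3', ← h3', e']
  · obtain ⟨s, hs1, hs2⟩ := h0.sec y (fun x hx => eZ.hom (σ x hx)) fun x hx => by rw [h1', hσ]
    obtain ⟨y', rfl⟩ := bY.2 s
    refine ⟨y', (h4' y').symm.trans hs1, ?_⟩
    rintro x' rfl
    rw [hp]
    intro hh
    exact bZ.1 ((h2' x').trans (hs2 (eX.hom x') (h3' x').symm hh))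
  · refine bY.1 (h0.uniq _ _ (by rw [h4', h4', e]) fun w w' hw hw' hpp => ?_)
    obtain ⟨z, rfl⟩ := bX.2 w
    obtain ⟨z', rfl⟩ := bX.2 w'
    rw [← h3'] at hw hw'
    rw [← h2', ← h2']
    exact congrArg eZ.hom (h z z' (bY.1 hw) (bY.1 hw') (by rw [hp, hp, hpp]))

end CSet

open CSet

section Tambarization

variable {G : Type u} [Group G] {𝒯 : TambaraSystem G} (M : SemiMackey 𝒯.mul)

theorem SemiMackey.res_id (X : CSet 𝒯.C) (m : M.obj X) : M.res (𝟙 X) m = m := M.laws.res_id X m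

theorem SemiMackey.res_res {X Y Z : CSet 𝒯.C} (f : X ⟶ Y) (g : Y ⟶ Z) (m : M.obj Z) :
    M.res f (M.res g m) = M.res (f ≫ g) m := (M.laws.res_comp f g m).symm

theorem SemiMackey.res_tr {X' Y' X Y : CSet 𝒯.C} {f' : X' ⟶ X} {g' : X' ⟶ Y'} {g : X ⟶ Y}
    {f : Y' ⟶ Y} (h : PB f' g' g f) (hg : 𝒯.mul.IsTransfer g) (hg' : 𝒯.mul.IsTransfer g')
    (m : M.obj X) : M.res f (M.tr g hg m) = M.tr g' hg' (M.res f' m) :=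
  M.laws.mackey f' g' g f h.isPullback hg hg' m

theorem SemiMackey.sum_bij {A B C : CSet 𝒯.C} (i : A ⟶ C) (j : B ⟶ C)
    (h : Function.Bijective (Sum.elim i j)) :
    Function.Bijective (fun m : M.obj C => (M.res i m, M.res j m)) := by
  let F : ULift.{u} Bool → CSet 𝒯.C := fun b => Bool.rec A B b.down
  let f : ∀ b, F b ⟶ C := fun b => Bool.rec (motive := fun c => F ⟨c⟩ ⟶ C) i j b.down
  have hb := M.laws.additive C F f (by
    constructor
    · rintro ⟨⟨_ | _⟩, x⟩ ⟨⟨_ | _⟩, y⟩ e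
      · obtain rfl := Sum.inl_injective (h.1 (a₁ := Sum.inl x) (a₂ := Sum.inl y) e)
        rfl
      · exact absurd (h.1 (a₁ := Sum.inl x) (a₂ := Sum.inr y) e) Sum.inl_ne_inr
      · exact absurd (h.1 (a₁ := Sum.inr x) (a₂ := Sum.inl y) e) Sum.inr_ne_inl
      · obtain rfl := Sum.inr_injective (h.1 (a₁ := Sum.inr x) (a₂ := Sum.inr y) e)
        rfl
    · intro c
      obtain ⟨x | x, e⟩ := h.2 c
      · exact ⟨⟨⟨false⟩, x⟩, e⟩
      · exact ⟨⟨⟨true⟩, x⟩, e⟩)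
  constructor
  · intro m m' e
    refine hb.1 (funext ?_)
    rintro ⟨_ | _⟩
    · exact congrArg Prod.fst e
    · exact congrArg Prod.snd e
  · rintro ⟨a, b⟩
    obtain ⟨m, hm⟩ := hb.2 (fun b' => Bool.rec (motive := fun c => M.obj (F ⟨c⟩)) a b b'.down)
    exact ⟨m, Prod.ext (congrFun hm ⟨false⟩) (congrFun hm ⟨true⟩)⟩

theorem SemiMackey.eq_of_isEmpty {X : CSet 𝒯.C} (h : IsEmpty X) (m m' : M.obj X) : m = m' := by
  refine (M.laws.additive X (Λ := PEmpty) (fun l => l.elim) (fun l => l.elim) ?_).1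
    (funext fun l => l.elim)
  exact ⟨fun z => z.1.elim, fun x => (h.false x).elim⟩

/-- The element `m_A ⨿ m_B` of `M(A ⨿ B)`. -/
noncomputable def SemiMackey.glue {A B : CSet 𝒯.C} (a : M.obj A) (b : M.obj B) : M.obj (sum A B) :=
  (Equiv.ofBijective _ (M.sum_bij (inl A B) (inr A B) (CSet.sum_bij A B))).symm (a, b)

theorem SemiMackey.res_glue {A B : CSet 𝒯.C} (a : M.obj A) (b : M.obj B) :
    M.res (inl A B) (M.glue a b) = a ∧ M.res (inr A B) (M.glue a b) = b :=
  Prod.ext_iff.1 ((Equiv.ofBijective _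
    (M.sum_bij (inl A B) (inr A B) (CSet.sum_bij A B))).apply_symm_apply (a, b))

theorem SemiMackey.eq_glue {A B : CSet 𝒯.C} {a : M.obj A} {b : M.obj B} {m : M.obj (sum A B)}
    (ha : M.res (inl A B) m = a) (hb : M.res (inr A B) m = b) : m = M.glue a b :=
  (M.sum_bij (inl A B) (inr A B) (CSet.sum_bij A B)).1
    (Prod.ext (ha.trans (M.res_glue a b).1.symm) (hb.trans (M.res_glue a b).2.symm))

/-- Objects `(A → X, m_A)` of the category of `𝒞`-sets over `X` with coefficients in `M`:
`p` is a morphism of `𝒞_{𝒪_𝒞}`, and `m_A ∈ M(A)`. -/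
structure MOver (X : CSet 𝒯.C) where
  A : CSet 𝒯.C
  p : A ⟶ X
  hp : 𝒯.nat.IsTransfer p
  m : M.obj A

/-- Morphisms from `(A, m_A)` to `(B, m_B)`. -/
@[ext] structure MOver.Hom {M : SemiMackey 𝒯.mul} {X : CSet 𝒯.C} (a b : MOver M X) where
  hom : a.A ⟶ b.A
  w : hom ≫ b.p = a.p
  res_m : M.res hom b.m = a.m

instance (X : CSet 𝒯.C) : Category (MOver M X) where
  Hom a b := MOver.Hom a b
  id a := ⟨𝟙 a.A, Category.id_comp _, M.res_id _ _⟩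
  comp f g := ⟨f.hom ≫ g.hom, by rw [Category.assoc, g.w, f.w],
    by rw [← M.res_res, g.res_m, f.res_m]⟩

variable {M}

/-- Isomorphisms in `MOver M X` are given by bijective morphisms. -/
theorem MOver.iso_iff {X : CSet 𝒯.C} (a b : MOver M X) : Nonempty (a ≅ b) ↔
    ∃ e : a.A ⟶ b.A, Function.Bijective e ∧ (∀ x, b.p (e x) = a.p x) ∧ M.res e b.m = a.m := by
  constructor
  · rintro ⟨e⟩
    have h1 : e.hom.hom ≫ e.inv.hom = 𝟙 a.A := congrArg MOver.Hom.hom e.hom_inv_id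
    have h2 : e.inv.hom ≫ e.hom.hom = 𝟙 b.A := congrArg MOver.Hom.hom e.inv_hom_id
    exact ⟨e.hom.hom, bij_of_iso ⟨e.hom.hom, e.inv.hom, h1, h2⟩,
      fun x => congrArg (fun k : a.A ⟶ X => k x) e.hom.w, e.hom.res_m⟩
  · rintro ⟨e, he, hw, hm⟩
    let i := isoOfBij e he
    have hw' : e ≫ b.p = a.p := hom_ext' hw
    have h1 : i.inv ≫ e = 𝟙 b.A := i.inv_hom_id
    have h2 : e ≫ i.inv = 𝟙 a.A := i.hom_inv_id
    exact ⟨⟨⟨e, hw', hm⟩, ⟨i.inv, by rw [← hw', ← Category.assoc, h1, Category.id_comp],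
      by rw [← hm, M.res_res, h1, M.res_id]⟩, MOver.Hom.ext h2, MOver.Hom.ext h1⟩⟩

variable (M)

theorem MOver.small (X : CSet 𝒯.C) :
    Small.{u} (Quotient (isIsomorphicSetoid (MOver M X))) := by
  let P : Type u := Σ (s : Set (X × ℕ)) (act : MulAction G s)
    (h : PLift (∀ x : s, stabilizer G x ∈ 𝒯.C))
    (p : (CSet.mk s h.down : CSet 𝒯.C) ⟶ X), PLift (𝒯.nat.IsTransfer p) × M.obj (CSet.mk s h.down)
  let F : P → Quotient (isIsomorphicSetoid (MOver M X)) := fun z =>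
    Quotient.mk (isIsomorphicSetoid (MOver M X))
      (letI := z.2.1; ⟨CSet.mk z.1 z.2.2.1.down, z.2.2.2.1, z.2.2.2.2.1.down, z.2.2.2.2.2⟩)
  refine small_of_surjective (f := F) fun q => ?_
  induction q using Quotient.inductionOn with
  | h a =>
  obtain ⟨A, p, hp, m⟩ := a
  choose f hf using fun x => Set.countable_iff_exists_injOn.1 (hp.1 x).countable
  have hinj : Function.Injective (fun a : A => ((p a, f (p a) a) : X × ℕ)) := fun a b h => by
    have h1 : p a = p b := congrArg Prod.fst h
    have h2 : f (p a) a = f (p b) b := congrArg Prod.snd h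
    rw [← h1] at h2
    exact hf (p a) rfl h1.symm h2
  let e := Equiv.ofInjective _ hinj
  let act : MulAction G (Set.range fun a : A => ((p a, f (p a) a) : X × ℕ)) := e.symm.mulAction G
  have hact : ∀ (g : G) x, e.symm (g • x) = g • e.symm x := fun g x => e.symm_apply_apply _
  have hst : ∀ x : (Set.range fun a : A => ((p a, f (p a) a) : X × ℕ)), stabilizer G x ∈ 𝒯.C := by
    intro x
    have : stabilizer G x = stabilizer G (e.symm x) := by
      ext g
      rw [mem_stabilizer_iff, mem_stabilizer_iff, ← hact, e.symm.apply_eq_iff_eq]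
    rw [this]
    exact A.stab_mem _
  let k : (CSet.mk _ hst : CSet 𝒯.C) ⟶ A := mkHom e.symm hact
  refine ⟨⟨_, act, ⟨hst⟩, k ≫ p, ⟨nat_isTransfer
    ((FiniteFibers.of_bij k e.symm.injective).comp hp.1)⟩, M.res k m⟩, Quotient.sound ?_⟩
  exact (MOver.iso_iff _ _).2 ⟨k, e.symm.bijective, fun _ => rfl, rfl⟩

instance (X : CSet 𝒯.C) : Small.{u} (Quotient (isIsomorphicSetoid (MOver M X))) :=
  MOver.small M X

/-- `𝒮_M(X)`: the set of isomorphism classes of objects of `MOver M X`. -/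
def SM (X : CSet 𝒯.C) : Type u := Shrink.{u} (Quotient (isIsomorphicSetoid (MOver M X)))

variable {M}

namespace SM

variable {X Y : CSet 𝒯.C}

/-- The isomorphism class of an object. -/
noncomputable def mk (a : MOver M X) : SM M X := equivShrink _ (Quotient.mk _ a)

/-- A representative of an isomorphism class. -/
noncomputable def rep (s : SM M X) : MOver M X := ((equivShrink _).symm s).out

theorem mk_rep (s : SM M X) : mk s.rep = s := by
  rw [mk, rep, Quotient.out_eq]
  exact (equivShrink _).apply_symm_apply s

theorem mk_eq_mk (a b : MOver M X) : mk a = mk b ↔ Nonempty (a ≅ b) := by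
  refine (equivShrink (Quotient (isIsomorphicSetoid (MOver M X)))).apply_eq_iff_eq.trans ?_
  exact Quotient.eq (r := isIsomorphicSetoid (MOver M X))

/-- The class of `(A → X, m)`. -/
noncomputable def cls {A : CSet 𝒯.C} (p : A ⟶ X) (hp : FiniteFibers p) (m : M.obj A) : SM M X :=
  mk ⟨A, p, nat_isTransfer hp, m⟩

theorem sound {A B : CSet 𝒯.C} {p : A ⟶ X} {hp : FiniteFibers p} {a : M.obj A} {q : B ⟶ X}
    {hq : FiniteFibers q} {b : M.obj B} (e : A ⟶ B) (he : Function.Bijective e)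
    (w : ∀ x, q (e x) = p x) (hm : M.res e b = a) : cls p hp a = cls q hq b :=
  (mk_eq_mk _ _).2 ((MOver.iso_iff _ _).2 ⟨e, he, w, hm⟩)

theorem exact {A B : CSet 𝒯.C} {p : A ⟶ X} {hp : FiniteFibers p} {a : M.obj A} {q : B ⟶ X}
    {hq : FiniteFibers q} {b : M.obj B} (h : cls p hp a = cls q hq b) :
    ∃ e : A ⟶ B, Function.Bijective e ∧ (∀ x, q (e x) = p x) ∧ M.res e b = a :=
  (MOver.iso_iff _ _).1 ((mk_eq_mk _ _).1 h)

theorem ind {motive : SM M X → Prop}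
    (h : ∀ (A : CSet 𝒯.C) (p : A ⟶ X) (hp : FiniteFibers p) (m : M.obj A), motive (cls p hp m))
    (s : SM M X) : motive s := by
  rw [← mk_rep s]
  exact h _ _ s.rep.hp.1 _

theorem rep_spec {A : CSet 𝒯.C} (p : A ⟶ X) (hp : FiniteFibers p) (a : M.obj A) :
    ∃ e : A ⟶ (cls p hp a).rep.A, Function.Bijective e ∧
      (∀ x, (cls p hp a).rep.p (e x) = p x) ∧ M.res e (cls p hp a).rep.m = a :=
  exact (hq := (cls p hp a).rep.hp.1) (mk_rep (cls p hp a)).symm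

theorem cls_congr {A : CSet 𝒯.C} {p q : A ⟶ X} (hp : FiniteFibers p) (hq : FiniteFibers q)
    {a b : M.obj A} (h : ∀ x, p x = q x) (hab : a = b) : cls p hp a = cls q hq b := by
  obtain rfl := hom_ext' h
  obtain rfl := hab
  rfl

/-- The sum of two objects is `(A ⨿ B → X, m_A ⨿ m_B)`. -/
noncomputable instance : Add (SM M X) :=
  ⟨fun s t => cls (elim s.rep.p t.rep.p) (s.rep.hp.1.elim t.rep.hp.1) (M.glue s.rep.m t.rep.m)⟩

/-- The class of the empty set over `X`. -/
noncomputable instance : Zero (SM M X) := ⟨cls (fromEmpty X) (FiniteFibers.fromEmpty X) 1⟩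

/-- The product of two objects is `(A ×_X B → X, M^*(ϖ₁)(m_A) · M^*(ϖ₂)(m_B))`. -/
noncomputable instance : Mul (SM M X) :=
  ⟨fun s t => cls (fst s.rep.p t.rep.p ≫ s.rep.p)
    ((FiniteFibers.pb (pb_PB _ _).symm t.rep.hp.1).comp s.rep.hp.1)
    (M.res (fst s.rep.p t.rep.p) s.rep.m * M.res (snd s.rep.p t.rep.p) t.rep.m)⟩

/-- The class of `(X = X, 1)`. -/
noncomputable instance : One (SM M X) := ⟨cls (𝟙 X) (FiniteFibers.id X) 1⟩

theorem add_cls {A B C : CSet 𝒯.C} {p : A ⟶ X} {hp : FiniteFibers p} {a : M.obj A} {q : B ⟶ X}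
    {hq : FiniteFibers q} {b : M.obj B} (r : C ⟶ X) (hr : FiniteFibers r) (c : M.obj C)
    (i : A ⟶ C) (j : B ⟶ C) (hb : Function.Bijective (Sum.elim i j)) (hi : ∀ x, r (i x) = p x)
    (hj : ∀ x, r (j x) = q x) (hca : M.res i c = a) (hcb : M.res j c = b) :
    cls p hp a + cls q hq b = cls r hr c := by
  obtain ⟨e, he, hep, hea⟩ := rep_spec p hp a
  obtain ⟨f, hf, hfq, hfb⟩ := rep_spec q hq b
  refine (sound (mkHom (Sum.elim (e ≫ inl _ _) (f ≫ inr _ _))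
    (by rintro g (x | x) <;> exact map_smul' _ _ _) : CSet.sum A B ⟶ _) ?_ ?_ rfl).symm.trans
      (sound (hp := hp.elim hq) (elim i j) hb ?_ ?_)
  · constructor
    · rintro (x | x) (y | y) h
      · exact congrArg Sum.inl (he.1 (Sum.inl_injective h))
      · exact absurd h Sum.inl_ne_inr
      · exact absurd h Sum.inr_ne_inl
      · exact congrArg Sum.inr (hf.1 (Sum.inr_injective h))
    · rintro (x | x)
      · obtain ⟨x, rfl⟩ := he.2 x
        exact ⟨Sum.inl x, rfl⟩
      · obtain ⟨x, rfl⟩ := hf.2 x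
        exact ⟨Sum.inr x, rfl⟩
  · rintro (x | x)
    · exact hep x
    · exact hfq x
  · rintro (x | x)
    · exact hi x
    · exact hj x
  · refine (M.sum_bij _ _ (CSet.sum_bij A B)).1 (Prod.ext ?_ ?_)
    · refine (M.res_res _ _ _).trans (Eq.trans ?_ (M.res_res _ _ _).symm)
      refine Eq.trans (b := a) hca ?_
      refine Eq.trans ?_ (M.res_res e (inl _ _) _)
      rw [(M.res_glue _ _).1, hea]
    · refine (M.res_res _ _ _).trans (Eq.trans ?_ (M.res_res _ _ _).symm)
      refine Eq.trans (b := b) hcb ?_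
      refine Eq.trans ?_ (M.res_res f (inr _ _) _)
      rw [(M.res_glue _ _).2, hfb]

theorem add_cls' {A B : CSet 𝒯.C} {p : A ⟶ X} {hp : FiniteFibers p} {a : M.obj A} {q : B ⟶ X}
    {hq : FiniteFibers q} {b : M.obj B} :
    cls p hp a + cls q hq b = cls (elim p q) (hp.elim hq) (M.glue a b) :=
  add_cls _ _ _ (inl A B) (inr A B) (CSet.sum_bij A B) (fun _ => rfl) (fun _ => rfl)
    (M.res_glue a b).1 (M.res_glue a b).2

theorem zero_eq {A : CSet 𝒯.C} (hA : IsEmpty A) (p : A ⟶ X) (hp : FiniteFibers p) (a : M.obj A) :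
    0 = cls p hp a :=
  sound (fromEmpty A) ⟨fun x => PEmpty.elim x, fun x => (hA.false x).elim⟩
    (fun x => PEmpty.elim x) (M.eq_of_isEmpty ⟨fun x => PEmpty.elim x⟩ _ _)

theorem mul_cls {A B C : CSet 𝒯.C} {p : A ⟶ X} {hp : FiniteFibers p} {a : M.obj A} {q : B ⟶ X}
    {hq : FiniteFibers q} {b : M.obj B} {i : C ⟶ A} {j : C ⟶ B} (h : PB i j p q) (r : C ⟶ X)
    (hr : FiniteFibers r) (hi : ∀ x, r x = p (i x)) (c : M.obj C)
    (hc : c = M.res i a * M.res j b) :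
    cls p hp a * cls q hq b = cls r hr c := by
  obtain ⟨e, he, hep, hea⟩ := rep_spec p hp a
  obtain ⟨f, hf, hfq, hfb⟩ := rep_spec q hq b
  have h0 : ∀ z, (cls p hp a).rep.p (e (i z)) = (cls q hq b).rep.p (f (j z)) := fun z => by
    rw [hep, hfq, h.comm]
  refine (sound (mkHom (fun z => ⟨(e (i z), f (j z)), h0 z⟩) fun g z => Subtype.ext (Prod.ext
    (map_smul' (i ≫ e) g z) (map_smul' (j ≫ f) g z)) : C ⟶ CSet.pb _ _) ⟨?_, ?_⟩ ?_ ?_).symm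
  · intro z z' hz
    refine h.uniq _ _ (he.1 ?_) (hf.1 ?_)
    · exact congrArg (fun w => w.1.1) hz
    · exact congrArg (fun w => w.1.2) hz
  · rintro ⟨⟨x, y⟩, hxy⟩
    obtain ⟨x, rfl⟩ := he.2 x
    obtain ⟨y, rfl⟩ := hf.2 y
    obtain ⟨z, rfl, rfl⟩ := h.lift x y ((hep x).symm.trans (hxy.trans (hfq y)))
    exact ⟨z, rfl⟩
  · intro z
    exact (hep (i z)).trans (hi z).symm
  · rw [map_mul, M.res_res, M.res_res, hc]
    congr 1
    · exact (M.res_res i e _).symm.trans (congrArg _ hea)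
    · exact (M.res_res j f _).symm.trans (congrArg _ hfb)

theorem mul_cls' {A B : CSet 𝒯.C} {p : A ⟶ X} {hp : FiniteFibers p} {a : M.obj A} {q : B ⟶ X}
    {hq : FiniteFibers q} {b : M.obj B} :
    cls p hp a * cls q hq b = cls (fst p q ≫ p) ((FiniteFibers.pb (pb_PB _ _).symm hq).comp hp)
      (M.res (fst p q) a * M.res (snd p q) b) :=
  mul_cls (pb_PB p q) _ _ (fun _ => rfl) _ rfl

noncomputable instance : CommSemiring (SM M X) :=
  have hadd : ∀ s t : SM M X, s + t = t + s := fun s t => by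
    induction s using ind with | h A p hp a =>
    induction t using ind with | h B q hq b =>
    rw [add_cls' (p := q)]
    refine add_cls _ _ _ (inr B A) (inl B A) ?_ (fun _ => rfl) (fun _ => rfl)
      (M.res_glue b a).2 (M.res_glue b a).1
    have : Sum.elim (inr B A) (inl B A) = Sum.elim (inl B A) (inr B A) ∘ Sum.swap := by
      funext x
      rcases x with x | x <;> rfl
    rw [this]
    exact (CSet.sum_bij B A).comp (Equiv.sumComm A B).bijective
  have hmul : ∀ s t : SM M X, s * t = t * s := fun s t => by
    induction s using ind with | h A p hp a =>
    induction t using ind with | h B q hq b =>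
    rw [mul_cls' (p := q)]
    exact mul_cls (pb_PB q p).symm _ _ (fun z => (pb_PB q p).comm z) _ (mul_comm _ _)
  have hzero : ∀ s : SM M X, 0 + s = s := fun s => by
    induction s using ind with | h A p hp a =>
    refine add_cls _ _ _ (fromEmpty A) (𝟙 A) ⟨?_, ?_⟩ (fun x => PEmpty.elim x) (fun _ => rfl)
      (M.eq_of_isEmpty ⟨fun x => PEmpty.elim x⟩ _ _) (M.res_id _ _)
    · rintro (x | x) (y | y) h
      · exact PEmpty.elim x
      · exact PEmpty.elim x
      · exact PEmpty.elim y
      · exact congrArg Sum.inr h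
    · exact fun x => ⟨Sum.inr x, rfl⟩
  have hone : ∀ s : SM M X, 1 * s = s := fun s => by
    induction s using ind with | h A p hp a =>
    refine mul_cls (i := p) (j := 𝟙 A) ⟨fun _ => rfl, fun x z h => ⟨z, h.symm, rfl⟩,
      fun _ _ _ h => h⟩ _ _ (fun _ => rfl) _ ?_
    rw [map_one, one_mul, M.res_id]
  have hzm : ∀ s : SM M X, 0 * s = 0 := fun s => by
    induction s using ind with | h A p hp a =>
    refine Eq.trans (mul_cls' (hp := FiniteFibers.fromEmpty X)) (zero_eq ⟨fun x => ?_⟩ _ _ _).symm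
    exact PEmpty.elim x.1.1
  have hdistrib : ∀ s t v : SM M X, s * (t + v) = s * t + s * v := fun s t v => by
    induction s using ind with | h A p hp a =>
    induction t using ind with | h B q hq b =>
    induction v using ind with | h C r hr c =>
    rw [add_cls', mul_cls', mul_cls', mul_cls']
    refine (add_cls _ _ _
      (mkHom (fun z => ⟨(z.1.1, Sum.inl z.1.2), z.2⟩) fun _ _ => rfl : pb p q ⟶ pb p (elim q r))
      (mkHom (fun z => ⟨(z.1.1, Sum.inr z.1.2), z.2⟩) fun _ _ => rfl : pb p r ⟶ pb p (elim q r))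
      ⟨?_, ?_⟩ (fun _ => rfl) (fun _ => rfl) ?_ ?_).symm
    · rintro (⟨⟨x, y⟩, hx⟩ | ⟨⟨x, y⟩, hx⟩) (⟨⟨x', y'⟩, hx'⟩ | ⟨⟨x', y'⟩, hx'⟩) h
      · obtain rfl : x = x' := congrArg (fun w => w.1.1) h
        obtain rfl : y = y' := Sum.inl_injective (congrArg (fun w => w.1.2) h)
        rfl
      · exact absurd (congrArg (fun w => w.1.2) h) Sum.inl_ne_inr
      · exact absurd (congrArg (fun w => w.1.2) h) Sum.inr_ne_inl
      · obtain rfl : x = x' := congrArg (fun w => w.1.1) h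
        obtain rfl : y = y' := Sum.inr_injective (congrArg (fun w => w.1.2) h)
        rfl
    · rintro ⟨⟨x, y | y⟩, hx⟩
      · exact ⟨Sum.inl ⟨(x, y), hx⟩, rfl⟩
      · exact ⟨Sum.inr ⟨(x, y), hx⟩, rfl⟩
    · rw [map_mul, M.res_res, M.res_res]
      congr 1
      exact (M.res_res (snd p q) (inl B C) _).symm.trans (congrArg _ (M.res_glue b c).1)
    · rw [map_mul, M.res_res, M.res_res]
      congr 1
      exact (M.res_res (snd p r) (inr B C) _).symm.trans (congrArg _ (M.res_glue b c).2)
  { add_comm := hadd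
    zero_add := hzero
    add_zero := fun s => (hadd s 0).trans (hzero s)
    add_assoc := fun s t v => by
      induction s using ind with | h A p hp a =>
      induction t using ind with | h B q hq b =>
      induction v using ind with | h C r hr c =>
      rw [add_cls' (p := p), add_cls', add_cls']
      refine (add_cls _ _ _ (inl A B ≫ inl _ C)
        (elim (inr A B ≫ inl (CSet.sum A B) C) (inr (CSet.sum A B) C)) ?_ (fun _ => rfl) ?_ ?_ ?_).symm
      · have : Sum.elim (inl A B ≫ inl _ C)
            (elim (inr A B ≫ inl (CSet.sum A B) C) (inr (CSet.sum A B) C))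
            = (Equiv.sumAssoc A B C).symm := by
          funext x
          rcases x with x | x | x <;> rfl
        rw [this]
        exact (Equiv.sumAssoc A B C).symm.bijective
      · rintro (x | x) <;> rfl
      · rw [← M.res_res, (M.res_glue _ _).1, (M.res_glue _ _).1]
      · refine M.eq_glue ?_ ?_
        · refine (M.res_res _ _ _).trans ((M.res_res (inr A B) (inl _ C) _).symm.trans ?_)
          rw [(M.res_glue _ _).1, (M.res_glue _ _).2]
        · exact (M.res_res _ _ _).trans (M.res_glue _ _).2
    mul_comm := hmul
    one_mul := hone
    mul_one := fun s => (hmul s 1).trans (hone s)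
    zero_mul := hzm
    mul_zero := fun s => (hmul s 0).trans (hzm s)
    left_distrib := hdistrib
    right_distrib := fun s t v => by rw [hmul, hdistrib, hmul v, hmul v]
    mul_assoc := fun s t v => by
      induction s using ind with | h A p hp a =>
      induction t using ind with | h B q hq b =>
      induction v using ind with | h C r hr c =>
      rw [mul_cls' (p := p), mul_cls' (p := q), mul_cls']
      let j : pb (fst p q ≫ p) r ⟶ pb q r := mkHom
        (fun z => ⟨(z.1.1.1.2, z.1.2), z.1.1.2.symm.trans z.2⟩) fun _ _ => rfl
      refine (mul_cls (i := fst (fst p q ≫ p) r ≫ fst p q) (j := j) ⟨?_, ?_, ?_⟩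
        _ _ (fun _ => rfl) _ ?_).symm
      · rintro ⟨⟨⟨⟨x, y⟩, h⟩, z⟩, h'⟩
        exact h
      · rintro x ⟨⟨y, z⟩, h⟩ h'
        exact ⟨⟨(⟨(x, y), h'⟩, z), h'.trans h⟩, rfl, rfl⟩
      · rintro ⟨⟨⟨⟨x, y⟩, h⟩, z⟩, h'⟩ ⟨⟨⟨⟨x', y'⟩, k⟩, z'⟩, k'⟩ e e'
        obtain rfl : x = x' := e
        obtain rfl : y = y' := congrArg (fun w => w.1.1) e'
        obtain rfl : z = z' := congrArg (fun w => w.1.2) e'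
        rfl
      · rw [map_mul, map_mul, M.res_res, M.res_res, M.res_res, M.res_res, mul_assoc]
        rfl
    nsmul := nsmulRec }

end SM

namespace SM

variable {X Y : CSet 𝒯.C}

/-- `ζ^*(A → X, m) = (A' → Y, M^*(ζ')(m))`, where `A' = A ×_X Y`. -/
noncomputable def resFun (ζ : Y ⟶ X) (s : SM M X) : SM M Y :=
  cls (snd s.rep.p ζ) (FiniteFibers.pb (pb_PB _ _) s.rep.hp.1) (M.res (fst s.rep.p ζ) s.rep.m)

/-- `ξ_+(A → X, m) = (A → Y, m)`. -/
noncomputable def trAddFun (ξ : X ⟶ Y) (hξ : 𝒯.nat.IsTransfer ξ) (s : SM M X) : SM M Y :=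
  cls (s.rep.p ≫ ξ) (s.rep.hp.1.comp hξ.1) s.rep.m

theorem isTransfer_rho {A : CSet 𝒯.C} {η : X ⟶ Y} (hη : 𝒯.mul.IsTransfer η) (p : A ⟶ X) :
    𝒯.mul.IsTransfer (snd η (piProj η hη.1 p)) :=
  (pb_PB _ _).isTransfer hη

/-- `η_•(A → X, m) = (Π_η(A) → Y, M_*(ρ) M^*(λ) (m))`. -/
noncomputable def trMulFun (η : X ⟶ Y) (hη : 𝒯.mul.IsTransfer η) (s : SM M X) : SM M Y :=
  cls (piProj η hη.1 s.rep.p) (FiniteFibers.piProj hη.1 s.rep.hp.1)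
    (M.tr (snd η (piProj η hη.1 s.rep.p)) (isTransfer_rho hη _)
      (M.res (piEval η hη.1 s.rep.p) s.rep.m))

theorem res_cls {A A' : CSet 𝒯.C} {p : A ⟶ X} {hp : FiniteFibers p} {a : M.obj A} {ζ : Y ⟶ X}
    {ζ' : A' ⟶ A} {p' : A' ⟶ Y} (h : PB ζ' p' p ζ) (hp' : FiniteFibers p') :
    resFun ζ (cls p hp a) = cls p' hp' (M.res ζ' a) := by
  obtain ⟨e, he, hep, hea⟩ := rep_spec p hp a
  have h0 : ∀ z, (cls p hp a).rep.p (e (ζ' z)) = ζ (p' z) := fun z => by rw [hep, h.comm]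
  refine (sound (mkHom (fun z => ⟨(e (ζ' z), p' z), h0 z⟩) fun g z => Subtype.ext (Prod.ext
    (map_smul' (ζ' ≫ e) g z) (map_smul' p' g z)) : A' ⟶ CSet.pb _ _) ⟨?_, ?_⟩ (fun _ => rfl) ?_).symm
  · intro z z' hz
    refine h.uniq _ _ (he.1 ?_) ?_
    · exact congrArg (fun w => w.1.1) hz
    · exact congrArg (fun w => w.1.2) hz
  · rintro ⟨⟨x, y⟩, hxy⟩
    obtain ⟨x, rfl⟩ := he.2 x
    obtain ⟨z, rfl, rfl⟩ := h.lift x y ((hep x).symm.trans hxy)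
    exact ⟨z, rfl⟩
  · refine (M.res_res _ _ _).trans ?_
    exact (M.res_res ζ' e _).symm.trans (congrArg _ hea)

theorem res_cls' {A : CSet 𝒯.C} {p : A ⟶ X} {hp : FiniteFibers p} {a : M.obj A} {ζ : Y ⟶ X} :
    resFun ζ (cls p hp a)
      = cls (snd p ζ) (FiniteFibers.pb (pb_PB _ _) hp) (M.res (fst p ζ) a) :=
  res_cls (pb_PB p ζ) _

theorem trAdd_cls {A : CSet 𝒯.C} {p : A ⟶ X} {hp : FiniteFibers p} {a : M.obj A} {ξ : X ⟶ Y}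
    {hξ : 𝒯.nat.IsTransfer ξ} :
    trAddFun ξ hξ (cls p hp a) = cls (p ≫ ξ) (hp.comp hξ.1) a := by
  obtain ⟨e, he, hep, hea⟩ := rep_spec p hp a
  exact (sound e he (fun x => congrArg ξ (hep x)) hea).symm

theorem trMul_cls {A X' Y' : CSet 𝒯.C} {p : A ⟶ X} {hp : FiniteFibers p} {a : M.obj A}
    {η : X ⟶ Y} {hη : 𝒯.mul.IsTransfer η} {l : X' ⟶ A} {r : X' ⟶ Y'} {π : Y' ⟶ Y}
    (h : IsExp η p l r π) (hr : 𝒯.mul.IsTransfer r) (hπ : FiniteFibers π) :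
    trMulFun η hη (cls p hp a) = cls π hπ (M.tr r hr (M.res l a)) := by
  obtain ⟨e, he, hep, hea⟩ := rep_spec p hp a
  obtain ⟨E, E', hE, hEπ, hE', hpb⟩ := (h.trans_iso (cls p hp a).rep.p e he hep).exists_iso hη.1
  refine (sound E hE hEπ ?_).symm
  rw [M.res_tr hpb _ hr, M.res_res, hE', ← M.res_res, hea]

theorem trMul_cls' {A : CSet 𝒯.C} {p : A ⟶ X} {hp : FiniteFibers p} {a : M.obj A}
    {η : X ⟶ Y} {hη : 𝒯.mul.IsTransfer η} :
    trMulFun η hη (cls p hp a) = cls (piProj η hη.1 p) (FiniteFibers.piProj hη.1 hp)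
      (M.tr (snd η (piProj η hη.1 p)) (isTransfer_rho hη _) (M.res (piEval η hη.1 p) a)) :=
  trMul_cls (isExp_pi η hη.1 p) _ _

/-- `ζ^*` is a homomorphism of semirings. -/
noncomputable def res (ζ : Y ⟶ X) : SM M X →+* SM M Y where
  toFun := resFun ζ
  map_one' := by
    refine (res_cls (ζ' := ζ) (p' := 𝟙 Y) ⟨fun _ => rfl, fun x y h => ⟨y, h.symm, rfl⟩,
      fun _ _ _ h => h⟩ (FiniteFibers.id Y)).trans ?_
    rw [map_one]
    rfl
  map_zero' := (res_cls' (hp := FiniteFibers.fromEmpty X)).trans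
    (zero_eq ⟨fun z : pb (fromEmpty X) ζ => PEmpty.elim z.1.1⟩ _ _ _).symm
  map_add' s t := by
    induction s using ind with | h A p hp a =>
    induction t using ind with | h B q hq b =>
    rw [add_cls', res_cls', res_cls', res_cls']
    refine (add_cls _ _ _
      (mkHom (fun z => ⟨(Sum.inl z.1.1, z.1.2), z.2⟩) fun _ _ => rfl : pb p ζ ⟶ pb (elim p q) ζ)
      (mkHom (fun z => ⟨(Sum.inr z.1.1, z.1.2), z.2⟩) fun _ _ => rfl : pb q ζ ⟶ pb (elim p q) ζ)
      ⟨?_, ?_⟩ (fun _ => rfl) (fun _ => rfl) ?_ ?_).symm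
    · rintro (⟨⟨x, y⟩, hx⟩ | ⟨⟨x, y⟩, hx⟩) (⟨⟨x', y'⟩, hx'⟩ | ⟨⟨x', y'⟩, hx'⟩) h
      · obtain rfl : x = x' := Sum.inl_injective (congrArg (fun w => w.1.1) h)
        obtain rfl : y = y' := congrArg (fun w => w.1.2) h
        rfl
      · exact absurd (congrArg (fun w => w.1.1) h) Sum.inl_ne_inr
      · exact absurd (congrArg (fun w => w.1.1) h) Sum.inr_ne_inl
      · obtain rfl : x = x' := Sum.inr_injective (congrArg (fun w => w.1.1) h)
        obtain rfl : y = y' := congrArg (fun w => w.1.2) h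
        rfl
    · rintro ⟨⟨x | x, y⟩, hx⟩
      · exact ⟨Sum.inl ⟨(x, y), hx⟩, rfl⟩
      · exact ⟨Sum.inr ⟨(x, y), hx⟩, rfl⟩
    · rw [M.res_res]
      exact (M.res_res (fst p ζ) (inl A B) _).symm.trans (congrArg _ (M.res_glue a b).1)
    · rw [M.res_res]
      exact (M.res_res (fst q ζ) (inr A B) _).symm.trans (congrArg _ (M.res_glue a b).2)
  map_mul' s t := by
    induction s using ind with | h A p hp a =>
    induction t using ind with | h B q hq b =>
    rw [mul_cls', res_cls', res_cls', res_cls']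
    let i : pb (fst p q ≫ p) ζ ⟶ pb p ζ := mkHom (fun z => ⟨(z.1.1.1.1, z.1.2), z.2⟩) fun _ _ => rfl
    let j : pb (fst p q ≫ p) ζ ⟶ pb q ζ :=
      mkHom (fun z => ⟨(z.1.1.1.2, z.1.2), z.1.1.2.symm.trans z.2⟩) fun _ _ => rfl
    refine (mul_cls (i := i) (j := j) ⟨fun _ => rfl, ?_, ?_⟩ _ _ (fun _ => rfl) _ ?_).symm
    · rintro ⟨⟨x, y⟩, h⟩ ⟨⟨x', y'⟩, h'⟩ e
      obtain rfl : y = y' := e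
      exact ⟨⟨(⟨(x, x'), h.trans h'.symm⟩, y), h⟩, rfl, rfl⟩
    · rintro ⟨⟨⟨⟨x, y⟩, h⟩, z⟩, h'⟩ ⟨⟨⟨⟨x', y'⟩, k⟩, z'⟩, k'⟩ e e'
      obtain rfl : x = x' := congrArg (fun w => w.1.1) e
      obtain rfl : y = y' := congrArg (fun w => w.1.1) e'
      obtain rfl : z = z' := congrArg (fun w => w.1.2) e'
      rfl
    · rw [map_mul, M.res_res, M.res_res, M.res_res, M.res_res]
      rfl

/-- `ξ_+` is an additive homomorphism. -/
noncomputable def trAdd (ξ : X ⟶ Y) (hξ : 𝒯.nat.IsTransfer ξ) : SM M X →+ SM M Y where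
  toFun := trAddFun ξ hξ
  map_zero' := (trAdd_cls (hp := FiniteFibers.fromEmpty X)).trans
    (zero_eq ⟨fun z => PEmpty.elim z⟩ _ _ _).symm
  map_add' s t := by
    induction s using ind with | h A p hp a =>
    induction t using ind with | h B q hq b =>
    rw [add_cls', trAdd_cls, trAdd_cls, trAdd_cls]
    exact (add_cls _ _ _ (inl A B) (inr A B) (CSet.sum_bij A B) (fun _ => rfl) (fun _ => rfl)
      (M.res_glue a b).1 (M.res_glue a b).2).symm

/-- The projection `Π_η(A) ×_Y Π_η(B) → Y`. -/
def pbProj {A B : CSet 𝒯.C} (η : X ⟶ Y) (hη : FiniteFibers η) (p : A ⟶ X) (q : B ⟶ X) :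
    pb (piProj η hη p) (piProj η hη q) ⟶ Y :=
  fst (piProj η hη p) (piProj η hη q) ≫ piProj η hη p

/-- Evaluation of pairs of sections. -/
def pbEval {A B : CSet 𝒯.C} (η : X ⟶ Y) (hη : FiniteFibers η) (p : A ⟶ X) (q : B ⟶ X) :
    pb η (pbProj η hη p q) ⟶ pb p q :=
  mkHom (fun z => ⟨(z.1.2.1.1.sec ⟨z.1.1, z.2⟩, z.1.2.1.2.sec ⟨z.1.1, z.2.trans z.1.2.2⟩),
      (PiPt.sec_spec z.1.2.1.1 _).trans
        (PiPt.sec_spec z.1.2.1.2 ⟨z.1.1, z.2.trans z.1.2.2⟩).symm⟩)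
    (fun g z => Subtype.ext (Prod.ext (PiPt.smul_sec g z.1.2.1.1 z.1.1 z.2 _)
      (PiPt.smul_sec g z.1.2.1.2 z.1.1 (z.2.trans z.1.2.2) _)))

theorem isExp_pb {A B : CSet 𝒯.C} (η : X ⟶ Y) (hη : FiniteFibers η) (p : A ⟶ X) (q : B ⟶ X) :
    IsExp η (fst p q ≫ p) (pbEval η hη p q) (snd η (pbProj η hη p q)) (pbProj η hη p q) := by
  refine ⟨⟨?_, ?_, ?_⟩, ?_, ?_⟩
  · rintro ⟨⟨x, ⟨⟨s, t⟩, h⟩⟩, h'⟩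
    exact (congrArg η (s.sec_spec _)).trans h'
  · rintro x ⟨⟨s, t⟩, h⟩ h'
    exact ⟨⟨(x, ⟨(s, t), h⟩), h'⟩, s.sec_spec _, rfl⟩
  · rintro ⟨⟨x, ⟨⟨s, t⟩, h⟩⟩, h'⟩ ⟨⟨x', st⟩, h3⟩ e e'
    obtain rfl : _ = st := e'
    have e1 : x = x' := (s.sec_spec ⟨x, h'⟩).symm.trans (e.trans (s.sec_spec ⟨x', h3⟩))
    subst e1
    rfl
  · intro y σ hσ
    let s : PiPt η p := ⟨y, fun x => (σ x.1 x.2).1.1, fun x => hσ x.1 x.2⟩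
    let t : PiPt η q := ⟨y, fun x => (σ x.1 x.2).1.2, fun x =>
      (σ x.1 x.2).2.symm.trans (hσ x.1 x.2)⟩
    refine ⟨(⟨(s, t), rfl⟩ : {z : PiPt η p × PiPt η q // z.1.pt = z.2.pt}), rfl, ?_⟩
    rintro ⟨⟨x, st⟩, h⟩ e hh
    obtain rfl : st = _ := e
    have key : ∀ x' (e : x' = x) (h' : η x' = y), σ x h = σ x' h' := by
      rintro x' rfl h'
      rfl
    exact key _ (hσ x h) _
  · rintro ⟨⟨s, t⟩, h⟩ ⟨⟨s', t'⟩, h'⟩ e hh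
    have e1 : s.pt = s'.pt := e
    have key : ∀ x (h1 : η x = s.pt) (h2 : η x = s'.pt), _ := fun x h1 h2 =>
      hh ⟨(x, ⟨(s, t), h⟩), h1⟩ ⟨(x, ⟨(s', t'), h'⟩), h2⟩ rfl rfl
        ((s.sec_spec ⟨x, h1⟩).trans (s'.sec_spec ⟨x, h2⟩).symm)
    refine Subtype.ext (Prod.ext (PiPt.ext' e1 fun x h1 h2 => ?_)
      (PiPt.ext' (h.symm.trans (e1.trans h')) fun x h1 h2 => ?_))
    · exact congrArg (fun w => w.1.1) (key x h1 h2)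
    · exact congrArg (fun w => w.1.2) (key x (h1.trans (Eq.symm h)) (h2.trans (Eq.symm h')))

/-- `η_•` is a multiplicative homomorphism. -/
noncomputable def trMul (η : X ⟶ Y) (hη : 𝒯.mul.IsTransfer η) : SM M X →* SM M Y where
  toFun := trMulFun η hη
  map_one' := by
    have h : IsExp η (𝟙 X) (𝟙 X) η (𝟙 Y) :=
      ⟨⟨fun _ => rfl, fun x y h => ⟨x, rfl, h⟩, fun _ _ h _ => h⟩,
        fun y σ hσ => ⟨y, rfl, fun x hx h => (hσ _ h).symm⟩, fun _ _ h _ => h⟩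
    refine (trMul_cls h hη (FiniteFibers.id Y)).trans ?_
    rw [map_one, map_one]
    rfl
  map_mul' s t := by
    induction s using ind with | h A p hp a =>
    induction t using ind with | h B q hq b =>
    rw [mul_cls', trMul_cls' (p := p), trMul_cls' (p := q), mul_cls',
      trMul_cls (isExp_pb η hη.1 p q) ((pb_PB _ _).isTransfer hη)
        ((isExp_pb η hη.1 p q).finite hη.1 ((FiniteFibers.pb (pb_PB _ _).symm hq).comp hp))]
    refine cls_congr _ _ (fun _ => rfl) ?_
    let P := pbProj η hη.1 p q
    let i : pb η P ⟶ pb η (piProj η hη.1 p) :=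
      mkHom (fun z => ⟨(z.1.1, z.1.2.1.1), z.2⟩) fun _ _ => rfl
    let j : pb η P ⟶ pb η (piProj η hη.1 q) :=
      mkHom (fun z => ⟨(z.1.1, z.1.2.1.2), z.2.trans z.1.2.2⟩) fun _ _ => rfl
    have hi : PB i (snd η P) (snd η (piProj η hη.1 p)) (fst _ (piProj η hη.1 q)) := by
      refine ⟨fun _ => rfl, ?_, ?_⟩
      · rintro ⟨⟨x, s⟩, h⟩ ⟨⟨s', t⟩, h'⟩ e
        obtain rfl : s = s' := e
        exact ⟨⟨(x, ⟨(s, t), h'⟩), h⟩, rfl, rfl⟩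
      · intro z z' e e'
        exact Subtype.ext (Prod.ext (congrArg (fun w => w.1.1) e) e')
    have hj : PB j (snd η P) (snd η (piProj η hη.1 q)) (snd (piProj η hη.1 p) _) := by
      refine ⟨fun _ => rfl, ?_, ?_⟩
      · rintro ⟨⟨x, s⟩, h⟩ ⟨⟨t, s'⟩, h'⟩ e
        obtain rfl : s = s' := e
        exact ⟨⟨(x, ⟨(t, s), h'⟩), h.trans (Eq.symm h')⟩, rfl, rfl⟩
      · intro z z' e e'
        exact Subtype.ext (Prod.ext (congrArg (fun w => w.1.1) e) e')
    have ei : pbEval η hη.1 p q ≫ fst p q = i ≫ piEval η hη.1 p := hom_ext' fun _ => rfl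
    have ej : pbEval η hη.1 p q ≫ snd p q = j ≫ piEval η hη.1 q := hom_ext' fun _ => rfl
    rw [map_mul, map_mul, M.res_res, M.res_res, M.res_tr hi _ ((pb_PB _ _).isTransfer hη),
      M.res_tr hj _ ((pb_PB _ _).isTransfer hη), M.res_res, M.res_res, ei, ej]

theorem res_id (s : SM M X) : resFun (𝟙 X) s = s := by
  induction s using ind with | h A p hp a =>
  refine (res_cls (ζ' := 𝟙 A) (p' := p) ⟨fun _ => rfl, fun x y h => ⟨x, rfl, h⟩,
      fun _ _ h _ => h⟩ hp).trans (cls_congr _ _ (fun _ => rfl) (M.res_id _ _))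

theorem res_comp {Z : CSet 𝒯.C} (f : X ⟶ Y) (g : Y ⟶ Z) (s : SM M Z) :
    resFun (f ≫ g) s = resFun f (resFun g s) := by
  induction s using ind with | h A p hp a =>
  rw [res_cls' (p := p) (ζ := g), res_cls' (ζ := f), M.res_res]
  refine res_cls ⟨?_, ?_, ?_⟩ _
  · rintro ⟨⟨⟨⟨x, y⟩, h⟩, z⟩, h'⟩
    exact h.trans (congrArg g h')
  · intro x z h
    exact ⟨⟨(⟨(x, f z), h⟩, z), rfl⟩, rfl, rfl⟩
  · rintro ⟨⟨⟨⟨x, y⟩, h⟩, z⟩, h'⟩ ⟨⟨⟨⟨x', y'⟩, k⟩, z'⟩, k'⟩ e e'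
    obtain rfl : x = x' := e
    obtain rfl : z = z' := e'
    obtain rfl : y = f z := h'
    obtain rfl : y' = f z := k'
    rfl

theorem eq_of_sigma {Λ : Type u} {A : Λ → CSet 𝒯.C} {C C' : CSet 𝒯.C} {r : C ⟶ X}
    {hr : FiniteFibers r} {c : M.obj C} {r' : C' ⟶ X} {hr' : FiniteFibers r'} {c' : M.obj C'}
    (j : ∀ l, A l ⟶ C) (j' : ∀ l, A l ⟶ C')
    (h : Function.Bijective (fun z : Σ l, A l => j z.1 z.2))
    (h' : Function.Bijective (fun z : Σ l, A l => j' z.1 z.2))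
    (hrr : ∀ l x, r (j l x) = r' (j' l x)) (hc : ∀ l, M.res (j l) c = M.res (j' l) c') :
    cls r hr c = cls r' hr' c' := by
  let J : sigma A ⟶ C := mkHom (fun z => j z.1 z.2) fun g z => map_smul' (j z.1) g z.2
  let J' : sigma A ⟶ C' := mkHom (fun z => j' z.1 z.2) fun g z => map_smul' (j' z.1) g z.2
  have hJ : M.res J c = M.res J' c' := by
    refine (M.laws.additive (sigma A) A (fun l => mkHom (fun x => ⟨l, x⟩) fun _ _ => rfl)
      ⟨fun z z' e => e, fun z => ⟨z, rfl⟩⟩).1 (funext fun l => ?_)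
    refine (M.res_res _ J _).trans (Eq.trans (hc l) (Eq.symm (M.res_res _ J' _)))
  refine (sound (hp := (FiniteFibers.of_bij J h.1).comp hr) J h (fun _ => rfl) rfl).symm.trans
    (sound J' h' (fun z => (hrr z.1 z.2).symm) hJ.symm)

theorem additive {Λ : Type u} (X : CSet 𝒯.C) (Xl : Λ → CSet 𝒯.C) (i : ∀ l, Xl l ⟶ X)
    (hi : Function.Bijective (fun z : Σ l, Xl l => i z.1 z.2)) :
    Function.Bijective (fun (m : SM M X) (l : Λ) => resFun (i l) m) := by
  have hbij : ∀ {A : CSet 𝒯.C} (p : A ⟶ X),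
      Function.Bijective (fun z : Σ l, pb p (i l) => fst p (i z.1) z.2) := by
    intro A p
    constructor
    · rintro ⟨l, ⟨⟨x, y⟩, h⟩⟩ ⟨l', ⟨⟨x', y'⟩, h'⟩⟩ e
      obtain rfl : x = x' := e
      have := hi.1 (a₁ := ⟨l, y⟩) (a₂ := ⟨l', y'⟩) (Eq.trans (Eq.symm h) h')
      obtain ⟨rfl, h2⟩ := Sigma.mk.inj_iff.1 this
      obtain rfl := eq_of_heq h2
      rfl
    · intro x
      obtain ⟨⟨l, y⟩, h⟩ := hi.2 (p x)
      exact ⟨⟨l, ⟨(x, y), Eq.symm h⟩⟩, rfl⟩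
  constructor
  · intro s t hst
    induction s using ind with | h A p hp a =>
    induction t using ind with | h B q hq b =>
    have h0 : ∀ l, _ := fun l => exact (res_cls'.symm.trans ((congrFun hst l).trans res_cls'))
    choose e he hw hm using h0
    refine eq_of_sigma (A := fun l => pb p (i l)) (fun l => fst p (i l))
      (fun l => e l ≫ fst q (i l)) (hbij p) ?_ ?_ ?_
    · exact (hbij q).comp (f := Sigma.map id fun l => e l)
        ⟨Function.Injective.sigma_map Function.injective_id fun l => (he l).1,
          Function.Surjective.sigma_map Function.surjective_id fun l => (he l).2⟩
    · intro l x
      refine ((pb_PB p (i l)).comm x).trans ?_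
      refine Eq.trans ?_ ((pb_PB q (i l)).comm (e l x)).symm
      exact congrArg (i l) (hw l x).symm
    · intro l
      rw [← M.res_res, hm]
  · intro s
    have hA : ∀ l, ∃ (A : CSet 𝒯.C) (p : A ⟶ Xl l) (hp : FiniteFibers p) (a : M.obj A),
        s l = cls p hp a := fun l =>
      ⟨_, _, (s l).rep.hp.1, _, (mk_rep (s l)).symm⟩
    choose A p hp a hs using hA
    obtain ⟨m, hm⟩ := (M.laws.additive (sigma A) A (fun l => mkHom (fun x => ⟨l, x⟩) fun _ _ => rfl)
      ⟨fun z z' e => e, fun z => ⟨z, rfl⟩⟩).2 a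
    let P : sigma A ⟶ X := mkHom (fun z => i z.1 (p z.1 z.2)) fun g z =>
      map_smul' (p z.1 ≫ i z.1) g z.2
    have hP : FiniteFibers P := by
      intro x
      obtain ⟨⟨l, y⟩, rfl⟩ := hi.2 x
      refine ((hp l y).image fun z => (⟨l, z⟩ : Σ l, A l)).subset ?_
      rintro ⟨l', z⟩ hz
      have := hi.1 (a₁ := ⟨l', p l' z⟩) (a₂ := ⟨l, y⟩) hz
      obtain ⟨rfl, h2⟩ := Sigma.mk.inj_iff.1 this
      exact ⟨z, eq_of_heq h2, rfl⟩
    refine ⟨cls P hP m, funext fun l => ?_⟩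
    refine Eq.trans ?_ (hs l).symm
    let j : A l ⟶ sigma A := mkHom (fun x => ⟨l, x⟩) fun _ _ => rfl
    refine (res_cls (ζ' := j) (p' := p l)
      ⟨fun _ => rfl, ?_, ?_⟩ (hp l)).trans (cls_congr _ _ (fun _ => rfl) (congrFun hm l))
    · rintro ⟨l', z⟩ y h
      have := hi.1 (a₁ := ⟨l', p l' z⟩) (a₂ := ⟨l, y⟩) h
      obtain ⟨rfl, h2⟩ := Sigma.mk.inj_iff.1 this
      exact ⟨z, rfl, eq_of_heq h2⟩
    · intro z z' h _
      exact eq_of_heq (Sigma.mk.inj_iff.1 h).2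

theorem addLaws : IsSemiMackey 𝒯.nat (SM M) (fun f => resFun f) (fun f hf => trAddFun f hf) where
  res_id _ := res_id
  res_comp := res_comp
  tr_id X h s := by
    induction s using ind with | h A p hp a =>
    exact trAdd_cls
  tr_comp f g hf hg hfg s := by
    induction s using ind with | h A p hp a =>
    rw [trAdd_cls (p := p), trAdd_cls (p := p), trAdd_cls]
    rfl
  mackey {X' Y' X Y} f' g' g f h hg hg' s := by
    have hP := PB.of_isPullback h
    induction s using ind with | h A p hp a =>
    rw [trAdd_cls, res_cls' (p := p), trAdd_cls]
    refine res_cls (ζ' := fst p f') (p' := snd p f' ≫ g') ⟨?_, ?_, ?_⟩ _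
    · rintro ⟨⟨x, z⟩, e⟩
      exact (congrArg g e).trans (hP.comm z)
    · intro x y e
      obtain ⟨z, h1, h2⟩ := hP.lift (p x) y e
      exact ⟨⟨(x, z), h1.symm⟩, rfl, h2⟩
    · rintro ⟨⟨x, z⟩, e⟩ ⟨⟨x', z'⟩, e'⟩ h1 h2
      obtain rfl : x = x' := h1
      obtain rfl : z = z' := hP.uniq z z' ((Eq.symm e).trans e') h2
      rfl
  additive := additive

theorem isExp_comp {A X' Y' Z W Y'' : CSet 𝒯.C} {η : X ⟶ Y} {p : A ⟶ X} {l : X' ⟶ A}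
    {r : X' ⟶ Y'} {π : Y' ⟶ Y} (h : IsExp η p l r π) {θ : Y ⟶ Z} {l' : Y'' ⟶ Y'} {r' : Y'' ⟶ W}
    {π' : W ⟶ Z} (h' : IsExp θ π l' r' π') :
    IsExp (η ≫ θ) p (fst r l' ≫ l) (snd r l' ≫ r') π' := by
  refine ⟨⟨?_, ?_, ?_⟩, ?_, ?_⟩
  · rintro ⟨⟨x, y⟩, e⟩
    exact (congrArg θ ((h.pbk.comm x).trans (congrArg π e))).trans (h'.pbk.comm y)
  · intro x w e
    obtain ⟨y, h1, h2⟩ := h'.pbk.lift (η x) w e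
    obtain ⟨x', h3, h4⟩ := h.pbk.lift x (l' y) h1.symm
    exact ⟨⟨(x', y), h4⟩, h3, h2⟩
  · rintro ⟨⟨x, y⟩, e⟩ ⟨⟨x', y'⟩, e'⟩ h1 h2
    have h3 : p (l x) = p (l x') := h1
    have h4 : r' y = r' y' := h2
    have h5 : π (l' y) = π (l' y') := by
      refine (congrArg π (Eq.symm e)).trans (Eq.trans ?_ (congrArg π e'))
      exact (h.pbk.comm x).symm.trans ((congrArg η h3).trans (h.pbk.comm x'))
    obtain rfl := h'.pbk.uniq y y' h5 h4
    obtain rfl := h.pbk.uniq x x' h3 (Eq.trans e (Eq.symm e'))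
    rfl
  · intro z σ hσ
    have h1 : ∀ y (_ : θ y = z), ∃ y', π y' = y ∧ ∀ x', r x' = y' → ∀ hh, l x' =
        σ (p (l x')) hh := fun y hy => by
      obtain ⟨y', h2, h3⟩ := h.sec y (fun x hx => σ x ((congrArg θ hx).trans hy))
        fun x hx => hσ x _
      refine ⟨y', h2, fun x' hx' hh => h3 x' hx' ?_⟩
      exact (h.pbk.comm x').trans ((congrArg π hx').trans h2)
    choose τ hτ1 hτ2 using h1
    obtain ⟨w, hw1, hw2⟩ := h'.sec z τ hτ1
    refine ⟨w, hw1, ?_⟩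
    rintro ⟨⟨x, y⟩, e⟩ hr hh
    have e0 : r x = l' y := e
    have h3 : θ (π (l' y)) = z := (h'.pbk.comm y).trans ((congrArg π' hr).trans hw1)
    exact hτ2 _ h3 x (e0.trans (hw2 y hr h3)) hh
  · intro w w' e hh
    refine h'.uniq w w' e fun y y' hy hy' hπ => ?_
    refine h.uniq _ _ hπ fun x x' hx hx' hp => ?_
    exact hh ⟨(x, y), hx⟩ ⟨(x', y'), hx'⟩ hy hy' hp

theorem isExp_pullback {A X' Y' X₁ Y₁ : CSet 𝒯.C} {η : X ⟶ Y} {p : A ⟶ X} {l : X' ⟶ A}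
    {r : X' ⟶ Y'} {π : Y' ⟶ Y} (h : IsExp η p l r π) {f' : X₁ ⟶ X} {η₁ : X₁ ⟶ Y₁} {f : Y₁ ⟶ Y}
    (hP : PB f' η₁ η f) :
    ∃ (W : CSet 𝒯.C) (L : W ⟶ pb p f') (R : W ⟶ pb π f) (k : W ⟶ X'),
      IsExp η₁ (snd p f') L R (snd π f) ∧ L ≫ fst p f' = k ≫ l ∧ PB k R r (fst π f) := by
  have hW : ∀ z : pb r (fst π f), η (p (l z.1.1)) = f (snd π f z.1.2) := fun z =>
    (h.pbk.comm _).trans ((congrArg π z.2).trans z.1.2.2)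
  choose m hm1 hm2 using fun z => hP.lift _ _ (hW z)
  have hm : ∀ (g : G) z, m (g • z) = g • m z := fun g z => by
    refine hP.uniq _ _ ?_ ?_
    · rw [hm1, map_smul', hm1]
      exact map_smul' (l ≫ p) g z.1.1
    · rw [hm2, map_smul', hm2]
      rfl
  let L : pb r (fst π f) ⟶ pb p f' := mkHom (fun z => ⟨(l z.1.1, m z), (hm1 z).symm⟩)
    fun g z => Subtype.ext (Prod.ext (map_smul' l g z.1.1) (hm g z))
  refine ⟨pb r (fst π f), L, snd _ _, fst _ _, ⟨⟨?_, ?_, ?_⟩, ?_, ?_⟩, rfl, pb_PB _ _⟩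
  · intro z
    exact hm2 z
  · rintro x ⟨⟨y', y₁⟩, e⟩ e'
    have e1 : η₁ x = y₁ := e'
    have e2 : π y' = f y₁ := e
    obtain ⟨x', h1, h2⟩ := h.pbk.lift (f' x) y' ((hP.comm x).trans ((congrArg f e1).trans e2.symm))
    refine ⟨⟨(x', ⟨(y', y₁), e⟩), h2⟩, hP.uniq _ _ ?_ ?_, rfl⟩
    · exact (hm1 _).trans h1
    · exact (hm2 _).trans e1.symm
  · rintro z z' e1 e2
    have e3 : m z = m z' := e1
    have e4 : p (l z.1.1) = p (l z'.1.1) := by rw [← hm1, ← hm1, e3]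
    refine Subtype.ext (Prod.ext (h.pbk.uniq _ _ e4 ?_) e2)
    exact z.2.trans ((congrArg (fst π f) e2).trans z'.2.symm)
  · intro y₁ σ hσ
    have h1 : ∀ x, η x = f y₁ → ∃ x₁, f' x₁ = x ∧ η₁ x₁ = y₁ := fun x hx => hP.lift x y₁ hx
    choose n hn1 hn2 using h1
    obtain ⟨y', hy1, hy2⟩ := h.sec (f y₁) (fun x hx => fst p f' (σ (n x hx) (hn2 x hx)))
      fun x hx => by
        rw [(pb_PB p f').comm, hσ, hn1]
    refine ⟨(⟨(y', y₁), hy1⟩ : {z : Y' × Y₁ // π z.1 = f z.2}), rfl, ?_⟩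
    intro z hz
    have hz1 : r z.1.1 = y' := (z.2).trans (congrArg (fst π f) hz)
    have hz2 : η (p (l z.1.1)) = f y₁ := (hW z).trans (congrArg (fun w => f (snd π f w)) hz)
    have hz3 : n (p (l z.1.1)) hz2 = m z := hP.uniq _ _ ((hn1 _ _).trans (hm1 z).symm)
      ((hn2 _ _).trans ((hm2 z).trans (congrArg (snd π f) hz)).symm)
    have key : ∀ x (hx : x = m z) (h1 : η₁ x = y₁) (h2 : η₁ (m z) = y₁), σ x h1 = σ (m z) h2 := by
      rintro x rfl h1 h2
      rfl
    intro hh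
    refine (pb_PB p f').uniq _ _ ?_ (hσ _ _).symm
    refine (hy2 z.1.1 hz1 hz2).trans (congrArg (fst p f') ?_)
    exact key _ hz3 _ _
  · rintro ⟨⟨y', y₁⟩, e⟩ ⟨⟨y'', y₂⟩, e'⟩ e1 hh
    obtain rfl : y₁ = y₂ := e1
    have e2 : π y' = π y'' := Eq.trans e (Eq.symm e')
    obtain rfl : y' = y'' := by
      refine h.uniq y' y'' e2 fun x x' hx hx' hp => ?_
      have h3 := hh ⟨(x, ⟨(y', y₁), e⟩), hx⟩ ⟨(x', ⟨(y'', y₁), e'⟩), hx'⟩ rfl rfl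
        (hP.uniq _ _ ((hm1 ⟨(x, ⟨(y', y₁), e⟩), hx⟩).trans (hp.trans
          (hm1 ⟨(x', ⟨(y'', y₁), e'⟩), hx'⟩).symm)) ((hm2 ⟨(x, ⟨(y', y₁), e⟩), hx⟩).trans
          (hm2 ⟨(x', ⟨(y'', y₁), e'⟩), hx'⟩).symm))
      exact congrArg (fun w => w.1.1) h3
    rfl

theorem isExp_id {A : CSet 𝒯.C} (p : A ⟶ X) : IsExp (𝟙 X) p (𝟙 A) (𝟙 A) p := by
  refine ⟨⟨fun _ => rfl, fun x a h => ⟨a, h.symm, rfl⟩, fun _ _ _ h => h⟩, fun x σ hσ => ?_,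
    fun a a' h h' => h' a a' rfl rfl h⟩
  refine ⟨σ x rfl, hσ _ _, ?_⟩
  rintro a ha
  obtain rfl : a = _ := ha
  intro hh
  have key : ∀ x' (e : x' = x) h, σ x rfl = σ x' h := by
    rintro _ rfl h
    rfl
  exact key _ (hσ x rfl) hh

theorem mulLaws : IsSemiMackey 𝒯.mul (SM M) (fun f => resFun f) (fun f hf => trMulFun f hf) where
  res_id _ := res_id
  res_comp := res_comp
  tr_id X h s := by
    induction s using ind with | h A p hp a =>
    have hA : 𝒯.mul.IsTransfer (𝟙 A) :=
      ⟨FiniteFibers.id A, fun x => 𝒯.self_mem _ (A.stab_mem x)⟩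
    refine (trMul_cls (isExp_id p) hA hp).trans ?_
    rw [M.res_id]
    exact cls_congr _ _ (fun _ => rfl) (M.laws.tr_id A hA a)
  tr_comp {X Y Z} f g hf hg hfg s := by
    induction s using ind with | h A p hp a =>
    have h1 := isExp_pi f hf.1 p
    have h2 := isExp_pi g hg.1 (piProj f hf.1 p)
    have h3 : 𝒯.mul.IsTransfer (snd (snd f (piProj f hf.1 p)) (piEval g hg.1 (piProj f hf.1 p))) :=
      (pb_PB _ _).isTransfer (isTransfer_rho hf p)
    rw [trMul_cls' (p := p) (η := f), trMul_cls' (η := g), trMul_cls (isExp_comp h1 h2)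
      (h3.comp (isTransfer_rho hg _)) ((isExp_comp h1 h2).finite hfg.1 hp)]
    refine cls_congr _ _ (fun _ => rfl) ?_
    rw [M.res_tr (pb_PB _ _) _ h3, M.res_res]
    exact M.laws.tr_comp _ _ h3 (isTransfer_rho hg _) _ _
  mackey {X' Y' X Y} f' g' g f h hg hg' s := by
    have hP := PB.of_isPullback h
    induction s using ind with | h A p hp a =>
    obtain ⟨W, L, R, k, hE, hL, hk⟩ := isExp_pullback (isExp_pi g hg.1 p) hP
    have hR : 𝒯.mul.IsTransfer R := hk.isTransfer (isTransfer_rho hg p)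
    rw [trMul_cls', res_cls', res_cls', trMul_cls hE hR
      (FiniteFibers.pb (pb_PB _ _) (FiniteFibers.piProj hg.1 hp))]
    refine cls_congr _ _ (fun _ => rfl) ?_
    rw [M.res_tr hk _ hR, M.res_res, M.res_res, hL]
  additive := additive

theorem isExp_push {Z X' Y' A V U : CSet 𝒯.C} {η : X ⟶ Y} {ξ : Z ⟶ X} {ζ : X' ⟶ Z}
    {η' : X' ⟶ Y'} {υ : Y' ⟶ Y} (h : IsExp η ξ ζ η' υ) {p : A ⟶ Z} {l : V ⟶ pb p ζ} {r : V ⟶ U}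
    {π : U ⟶ Y'} (h' : IsExp η' (snd p ζ) l r π) :
    IsExp η (p ≫ ξ) (l ≫ fst p ζ) r (π ≫ υ) := by
  have hl : ∀ v, p (fst p ζ (l v)) = ζ (snd p ζ (l v)) := fun v => (pb_PB p ζ).comm _
  have hl' : ∀ v, (p ≫ ξ) ((l ≫ fst p ζ) v) = ξ (ζ (snd p ζ (l v))) := fun v =>
    congrArg ξ (hl v)
  refine ⟨⟨?_, ?_, ?_⟩, ?_, ?_⟩
  · intro v
    refine (congrArg η (hl' v)).trans ((h.pbk.comm _).trans ?_)
    exact congrArg υ (h'.pbk.comm v)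
  · intro x w e
    obtain ⟨x', h1, h2⟩ := h.pbk.lift x (π w) e
    obtain ⟨v, h3, h4⟩ := h'.pbk.lift x' w h2
    have h5 : snd p ζ (l v) = x' := h3
    refine ⟨v, (hl' v).trans ?_, h4⟩
    rw [h5]
    exact h1
  · intro v v' e1 e2
    refine h'.pbk.uniq v v' ?_ e2
    refine h.pbk.uniq _ _ ((hl' v).symm.trans (e1.trans (hl' v'))) ?_
    exact (h'.pbk.comm v).trans ((congrArg π e2).trans (h'.pbk.comm v').symm)
  · intro y σ hσ
    obtain ⟨y', hy1, hy2⟩ := h.sec y (fun x hx => p (σ x hx)) hσ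
    have h1 : ∀ x', η' x' = y' → η (ξ (ζ x')) = y := fun x' hx' =>
      (h.pbk.comm x').trans ((congrArg υ hx').trans hy1)
    obtain ⟨w, hw1, hw2⟩ := h'.sec y' (fun x' hx' =>
      (⟨(σ (ξ (ζ x')) (h1 x' hx'), x'), (hy2 x' hx' (h1 x' hx')).symm⟩ :
        {z : A × X' // p z.1 = ζ z.2})) fun x' hx' => rfl
    refine ⟨w, (congrArg υ hw1).trans hy1, fun v hv => ?_⟩
    have h2 : η' (snd p ζ (l v)) = y' := (h'.pbk.comm v).trans ((congrArg π hv).trans hw1)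
    have h3 := congrArg (fst p ζ) (hw2 v hv h2)
    intro hh
    refine h3.trans ?_
    have key : ∀ x x' (_ : x = x') hx hx', σ x hx = σ x' hx' := by
      rintro x _ rfl hx hx'
      rfl
    exact key _ _ (hl' v).symm _ _
  · intro w w' e hh
    have key : ∀ v v', r v = w → r v' = w' → ξ (ζ (snd p ζ (l v))) = ξ (ζ (snd p ζ (l v'))) →
        fst p ζ (l v) = fst p ζ (l v') := fun v v' hv hv' e' =>
      hh v v' hv hv' ((hl' v).trans (e'.trans (hl' v').symm))
    have hπ : π w = π w' := by
      refine h.uniq _ _ e fun x x' hx hx' hp => ?_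
      obtain ⟨v, h1, h2⟩ := h'.pbk.lift x w hx
      obtain ⟨v', h3, h4⟩ := h'.pbk.lift x' w' hx'
      have h1' : snd p ζ (l v) = x := h1
      have h3' : snd p ζ (l v') = x' := h3
      have := congrArg p (key v v' h2 h4 (by rw [h1', h3', hp]))
      rw [hl, hl, h1', h3'] at this
      exact this
    refine h'.uniq w w' hπ fun v v' hv hv' e' => (pb_PB p ζ).uniq _ _ ?_ e'
    exact key v v' hv hv' (by rw [e'])

end SM

/-- The semi-Tambara functor `𝒮_M`. -/
noncomputable def SemiMackey.tambarization (M : SemiMackey 𝒯.mul) : SemiTambara 𝒯 where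
  obj := SM M
  res := SM.res
  trAdd := SM.trAdd
  trMul := SM.trMul
  addLaws := SM.addLaws
  mulLaws := SM.mulLaws
  exponential η ξ ζ η' υ hexp hη hξ hη' hυ s := by
    show SM.trAddFun υ hυ (SM.trMulFun η' hη' (SM.resFun ζ s))
      = SM.trMulFun η hη (SM.trAddFun ξ hξ s)
    induction s using SM.ind with | h A p hp a =>
    have h := hexp.isExp
    have h2 := SM.isExp_push h (isExp_pi η' hη'.1 (snd p ζ))
    rw [SM.res_cls', SM.trMul_cls', SM.trAdd_cls, SM.trAdd_cls, SM.trMul_cls h2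
      (SM.isTransfer_rho hη' _) ((FiniteFibers.piProj hη'.1
        (FiniteFibers.pb (pb_PB _ _) hp)).comp hυ.1), M.res_res]

/-- The map `(A → X, m) ↦ (A → X, φ_A(m))`. -/
noncomputable def SM.mapFun {M N : SemiMackey 𝒯.mul} (φ : M ⟶ N) {X : CSet 𝒯.C} (s : SM M X) :
    SM N X :=
  SM.mk ⟨s.rep.A, s.rep.p, s.rep.hp, φ.app s.rep.A s.rep.m⟩

theorem SM.map_cls {M N : SemiMackey 𝒯.mul} (φ : M ⟶ N) {X A : CSet 𝒯.C} {p : A ⟶ X}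
    {hp : FiniteFibers p} {a : M.obj A} :
    SM.mapFun φ (SM.cls p hp a) = SM.cls p hp (φ.app A a) := by
  obtain ⟨e, he, hep, hea⟩ := SM.rep_spec p hp a
  refine (SM.sound (hq := (SM.cls p hp a).rep.hp.1) e he hep ?_).symm
  rw [← φ.res_comm, hea]

/-- The homomorphism `𝒮_φ(X) : 𝒮_M(X) → 𝒮_N(X)`. -/
noncomputable def SM.map {M N : SemiMackey 𝒯.mul} (φ : M ⟶ N) (X : CSet 𝒯.C) :
    SM M X →+* SM N X where
  toFun := SM.mapFun φ
  map_zero' := (SM.map_cls (hp := FiniteFibers.fromEmpty X) φ).trans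
    (SM.zero_eq ⟨fun x => PEmpty.elim x⟩ _ _ _).symm
  map_one' := (SM.map_cls (hp := FiniteFibers.id X) φ).trans (by rw [map_one]; rfl)
  map_add' s t := by
    induction s using SM.ind with | h A p hp a =>
    induction t using SM.ind with | h B q hq b =>
    rw [SM.add_cls', SM.map_cls, SM.map_cls, SM.map_cls]
    refine (SM.add_cls _ _ _ (inl A B) (inr A B) (CSet.sum_bij A B) (fun _ => rfl) (fun _ => rfl)
      ?_ ?_).symm
    · rw [← φ.res_comm, (M.res_glue a b).1]
    · rw [← φ.res_comm, (M.res_glue a b).2]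
  map_mul' s t := by
    induction s using SM.ind with | h A p hp a =>
    induction t using SM.ind with | h B q hq b =>
    rw [SM.mul_cls', SM.map_cls, SM.map_cls, SM.map_cls, SM.mul_cls', map_mul, φ.res_comm,
      φ.res_comm]

/-- The functor `𝒮 : SMack → STam`. -/
noncomputable def tambarization (𝒯 : TambaraSystem G) : SemiMackey 𝒯.mul ⥤ SemiTambara 𝒯 where
  obj M := M.tambarization
  map {M N} φ :=
    { app := SM.map φ
      res_comm := fun f s => by
        show SM.mapFun φ (SM.resFun f s) = SM.resFun f (SM.mapFun φ s)
        induction s using SM.ind with | h A p hp a =>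
        rw [SM.res_cls', SM.map_cls, SM.map_cls, SM.res_cls', φ.res_comm]
      trAdd_comm := fun f hf s => by
        show SM.mapFun φ (SM.trAddFun f hf s) = SM.trAddFun f hf (SM.mapFun φ s)
        induction s using SM.ind with | h A p hp a =>
        rw [SM.trAdd_cls, SM.map_cls, SM.map_cls, SM.trAdd_cls]
      trMul_comm := fun f hf s => by
        show SM.mapFun φ (SM.trMulFun f hf s) = SM.trMulFun f hf (SM.mapFun φ s)
        induction s using SM.ind with | h A p hp a =>
        rw [SM.trMul_cls', SM.map_cls, SM.map_cls, SM.trMul_cls', φ.tr_comm, φ.res_comm] }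
  map_id M := SemiTambara.Hom.ext (funext fun X => RingHom.ext fun s => SM.mk_rep s)
  map_comp {M N L} φ ψ := SemiTambara.Hom.ext (funext fun X => RingHom.ext fun s => by
    show SM.mapFun (φ ≫ ψ) s = SM.mapFun ψ (SM.mapFun φ s)
    induction s using SM.ind with | h A p hp a =>
    rw [SM.map_cls, SM.map_cls, SM.map_cls]
    rfl)

end Tambarization

/-!
The unit of the adjunction is `M(X) → 𝒮_M(X)`, `m ↦ (X = X, m)`, and the counit is
`𝒮_{μ T}(X) → T(X)`, `(A, p, m) ↦ T_+(p)(m)`. The counit does not depend on the representative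
because additive transfer along a bijection is inverse to restriction (`trAdd_res`).

That the counit is additive is the additivity axiom: an element of `T(A ⨿ B)` is the sum of the
additive transfers of its restrictions (`eq_trAdd_add`). Compatibility with restriction is the
Mackey condition, and compatibility with multiplicative transfer is the exponential law. The point
with content is that the counit is multiplicative, that is, Frobenius reciprocity
`T_+(p ∘ ϖ₁)(ϖ₁^* a · ϖ₂^* b) = T_+(p)(a) · T_+(q)(b)` (`trAdd_mul_trAdd`). It also follows from the
exponential law: as `H ∈ 𝒪_• H`, the codiagonal `X ⨿ X → X` lies in `𝒞_{𝒪_•}`, multiplicative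
transfer along it is the product of `T(X)` (`trMul_codiag`), and the exponential of `A ⨿ B` along it
is `A ×_X B` (`isExp_codiag`).

The triangle identities say that `(A, p, m) = p_+(A = A, m)` in `𝒮_M(X)` and that `T_+` of an
identity is the identity.
-/

/-! ### Exponential diagrams and the codiagonal -/

namespace CSet

variable {G : Type u} [Group G] {𝒯 : TambaraSystem G}

/-- The converse of `IsExponential.isExp`. -/
theorem IsExp.isExponential {A X Y X' Y' : CSet 𝒯.C} {η : X ⟶ Y} {p : A ⟶ X} {l : X' ⟶ A}
    {r : X' ⟶ Y'} {π : Y' ⟶ Y} (h : IsExp η p l r π) (hη : 𝒯.mul.IsTransfer η)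
    (hp : 𝒯.nat.IsTransfer p) : IsExponential η p l r π := by
  obtain ⟨E, E', hE, hπ, hl, hpb⟩ := h.exists_iso hη.1
  -- a base change of the bijection `E` is bijective
  have hE' : Function.Bijective E' := by
    refine ⟨fun z z' e => hpb.uniq _ _ e (hE.1 ?_), fun w => ?_⟩
    · rw [← hpb.comm, ← hpb.comm, e]
    · obtain ⟨y, hy⟩ := hE.2 (snd η (piProj η hη.1 p) w)
      obtain ⟨z, hz, -⟩ := hpb.lift w y hy.symm
      exact ⟨z, hz⟩
  refine ⟨A, p, hp, hη, Iso.refl A, isoOfBij E' hE', isoOfBij E hE, Category.id_comp _, ?_, ?_,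
    hom_ext' hπ⟩
  · exact (Category.comp_id _).trans hl.symm
  · exact hom_ext' fun z => (hpb.comm z).symm

/-- Morphisms with finite fibers that do not enlarge stabilizers lie in `𝒞_{𝒪_•}`, because
`H ∈ 𝒪_• H`. -/
theorem mul_isTransfer {X Y : CSet 𝒯.C} {f : X ⟶ Y} (hf : FiniteFibers f)
    (h : ∀ x, stabilizer G (f x) ≤ stabilizer G x) : 𝒯.mul.IsTransfer f := by
  refine ⟨hf, fun x => ?_⟩
  rw [le_antisymm (h x) (stab_le f x)]
  exact 𝒯.self_mem _ (X.stab_mem x)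

theorem mul_isTransfer_of_injective {X Y : CSet 𝒯.C} {f : X ⟶ Y} (hf : Function.Injective f) :
    𝒯.mul.IsTransfer f := by
  refine mul_isTransfer (FiniteFibers.of_bij f hf) fun x g hg => hf ?_
  rw [map_smul']
  exact hg

/-- The codiagonal `X ⨿ X → X`. -/
def codiag (X : CSet 𝒯.C) : sum X X ⟶ X := elim (𝟙 X) (𝟙 X)

theorem codiag_isTransfer (X : CSet 𝒯.C) : 𝒯.mul.IsTransfer (codiag X) := by
  refine mul_isTransfer ((FiniteFibers.id X).elim (FiniteFibers.id X)) ?_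
  rintro (x | x) g hg
  · exact congrArg Sum.inl hg
  · exact congrArg Sum.inr hg

theorem inl_injective (A B : CSet 𝒯.C) : Function.Injective (inl A B) :=
  fun _ _ h => Sum.inl_injective h

theorem inr_injective (A B : CSet 𝒯.C) : Function.Injective (inr A B) :=
  fun _ _ h => Sum.inr_injective h

theorem PB.of_bijective {X Y : CSet 𝒯.C} {e : X ⟶ Y} (he : Function.Bijective e) :
    PB e e (𝟙 Y) (𝟙 Y) :=
  ⟨fun _ => rfl, fun a _ h => (he.2 a).imp fun _ hx => ⟨hx, hx.trans h⟩, fun _ _ h _ => he.1 h⟩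

theorem PB.of_injective {X Y : CSet 𝒯.C} {e : X ⟶ Y} (he : Function.Injective e) :
    PB (𝟙 X) (𝟙 X) e e :=
  ⟨fun _ => rfl, fun a _ h => ⟨a, rfl, he h⟩, fun _ _ h _ => h⟩

theorem PB.inl_inr (A B : CSet 𝒯.C) : PB (fromEmpty A) (fromEmpty B) (inl A B) (inr A B) :=
  ⟨fun z => PEmpty.elim z, fun _ _ h => (Sum.inl_ne_inr h).elim, fun z => PEmpty.elim z⟩

/-- The disjoint union `p ⨿ q : A ⨿ B → X ⨿ Y`. -/
def sumMap {A B X Y : CSet 𝒯.C} (p : A ⟶ X) (q : B ⟶ Y) : sum A B ⟶ sum X Y :=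
  elim (p ≫ inl X Y) (q ≫ inr X Y)

theorem FiniteFibers.sumMap {A B X Y : CSet 𝒯.C} {p : A ⟶ X} {q : B ⟶ Y} (hp : FiniteFibers p)
    (hq : FiniteFibers q) : FiniteFibers (sumMap p q) :=
  (hp.comp (of_bij _ (inl_injective X Y))).elim (hq.comp (of_bij _ (inr_injective X Y)))

/-- The exponential diagram over the codiagonal of `X`: a section of `p ⨿ q` over the two points
above `x` is a pair of points of `A` and `B` above `x`, so that `Π(A ⨿ B) = A ×_X B`. -/
theorem isExp_codiag {A B X : CSet 𝒯.C} (p : A ⟶ X) (q : B ⟶ X) :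
    IsExp (codiag X) (sumMap p q) (sumMap (fst p q) (snd p q)) (codiag (pb p q))
      (fst p q ≫ p) := by
  have e1 : ∀ z : pb p q, p z.1.1 = q z.1.2 := fun z => z.2
  refine ⟨⟨?_, ?_, ?_⟩, ?_, ?_⟩
  · rintro (z | z)
    · rfl
    · exact (e1 z).symm
  · rintro (x | x) z h
    · exact ⟨Sum.inl z, congrArg Sum.inl (Eq.symm h), rfl⟩
    · exact ⟨Sum.inr z, congrArg Sum.inr ((e1 z).symm.trans (Eq.symm h)), rfl⟩
  · rintro (z | z) (z' | z') h h'
    · exact congrArg Sum.inl h'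
    · exact (Sum.inl_ne_inr h).elim
    · exact (Sum.inr_ne_inl h).elim
    · exact congrArg Sum.inr h'
  · intro x σ hσ
    -- the section picks a point of `A` over the left copy of `x` and one of `B` over the right
    obtain ⟨a, ha⟩ : ∃ a, σ (Sum.inl x) rfl = Sum.inl a := by
      have h := hσ (Sum.inl x) rfl
      generalize σ (Sum.inl x) rfl = w at h ⊢
      rcases w with a | b
      · exact ⟨a, rfl⟩
      · exact (Sum.inr_ne_inl h).elim
    obtain ⟨b, hb⟩ : ∃ b, σ (Sum.inr x) rfl = Sum.inr b := by
      have h := hσ (Sum.inr x) rfl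
      generalize σ (Sum.inr x) rfl = w at h ⊢
      rcases w with a | b
      · exact (Sum.inl_ne_inr h).elim
      · exact ⟨b, rfl⟩
    have hpa : p a = x := Sum.inl_injective
      ((congrArg (sumMap p q) ha).symm.trans (hσ (Sum.inl x) rfl))
    have hqb : q b = x := Sum.inr_injective
      ((congrArg (sumMap p q) hb).symm.trans (hσ (Sum.inr x) rfl))
    have key : ∀ w w' (_ : w = w') h h', σ w h = σ w' h' := by
      rintro w _ rfl h h'
      rfl
    refine ⟨(⟨(a, b), hpa.trans hqb.symm⟩ : {z : A × B // p z.1 = q z.2}), hpa, ?_⟩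
    rintro (z | z) hz
    · obtain rfl : z = _ := hz
      intro h
      exact ha.symm.trans (key _ _ (congrArg Sum.inl hpa.symm) _ _)
    · obtain rfl : z = _ := hz
      intro h
      exact hb.symm.trans (key _ _ (congrArg Sum.inr hqb.symm) _ _)
  · intro z z' h hh
    have h' : p z.1.1 = p z'.1.1 := h
    refine (pb_PB p q).uniq _ _ ?_ ?_
    · exact Sum.inl_injective (hh (Sum.inl z) (Sum.inl z') rfl rfl (congrArg Sum.inl h'))
    · exact Sum.inr_injective (hh (Sum.inr z) (Sum.inr z') rfl rfl
        (congrArg Sum.inr ((e1 z).symm.trans (h'.trans (e1 z')))))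

/-- The exponential along `η` of the identity of `X` is the identity of `Y`. -/
theorem isExp_of_id {X Y : CSet 𝒯.C} (η : X ⟶ Y) : IsExp η (𝟙 X) (𝟙 X) η (𝟙 Y) :=
  ⟨⟨fun _ => rfl, fun x _ h => ⟨x, rfl, h⟩, fun _ _ h _ => h⟩,
    fun y _ hσ => ⟨y, rfl, fun _ _ h => (hσ _ h).symm⟩, fun _ _ h _ => h⟩

end CSet

/-! ### Sums and products in a semi-Tambara functor -/

namespace SemiTambara

variable {G : Type u} [Group G] {𝒯 : TambaraSystem G} (T : SemiTambara 𝒯)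

theorem res_res {X Y Z : CSet 𝒯.C} (f : X ⟶ Y) (g : Y ⟶ Z) (m : T.obj Z) :
    T.res f (T.res g m) = T.res (f ≫ g) m := (T.addLaws.res_comp f g m).symm

theorem res_trAdd {X' Y' X Y : CSet 𝒯.C} {f' : X' ⟶ X} {g' : X' ⟶ Y'} {g : X ⟶ Y} {f : Y' ⟶ Y}
    (h : PB f' g' g f) (hg : 𝒯.nat.IsTransfer g) (hg' : 𝒯.nat.IsTransfer g') (m : T.obj X) :
    T.res f (T.trAdd g hg m) = T.trAdd g' hg' (T.res f' m) :=
  T.addLaws.mackey f' g' g f h.isPullback hg hg' m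

theorem res_trMul {X' Y' X Y : CSet 𝒯.C} {f' : X' ⟶ X} {g' : X' ⟶ Y'} {g : X ⟶ Y} {f : Y' ⟶ Y}
    (h : PB f' g' g f) (hg : 𝒯.mul.IsTransfer g) (hg' : 𝒯.mul.IsTransfer g') (m : T.obj X) :
    T.res f (T.trMul g hg m) = T.trMul g' hg' (T.res f' m) :=
  T.mulLaws.mackey f' g' g f h.isPullback hg hg' m

theorem eq_of_isEmpty {X : CSet 𝒯.C} (h : IsEmpty X) (m m' : T.obj X) : m = m' :=
  ((forgetMul 𝒯).obj T).eq_of_isEmpty h m m'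

/-- Elements of `T(A ⨿ B)` are determined by their restrictions to `A` and `B`. -/
theorem eq_of_res_sum {A B : CSet 𝒯.C} {m m' : T.obj (sum A B)}
    (hl : T.res (inl A B) m = T.res (inl A B) m') (hr : T.res (inr A B) m = T.res (inr A B) m') :
    m = m' :=
  (((forgetMul 𝒯).obj T).sum_bij (inl A B) (inr A B) (CSet.sum_bij A B)).1 (Prod.ext hl hr)

/-- The additive transfer along a bijection is inverse to the restriction. -/
theorem trAdd_res {X Y : CSet 𝒯.C} {e : X ⟶ Y} (he : Function.Bijective e)
    (h : 𝒯.nat.IsTransfer e) (m : T.obj Y) : T.trAdd e h (T.res e m) = m := by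
  have hid := nat_isTransfer (FiniteFibers.id Y)
  rw [← T.res_trAdd (PB.of_bijective he) hid h, T.addLaws.tr_id]
  exact T.addLaws.res_id _ _

theorem res_trAdd_of_injective {X Y : CSet 𝒯.C} {e : X ⟶ Y} (he : Function.Injective e)
    (h : 𝒯.nat.IsTransfer e) (m : T.obj X) : T.res e (T.trAdd e h m) = m := by
  have hid := nat_isTransfer (FiniteFibers.id X)
  rw [T.res_trAdd (PB.of_injective he) h hid, T.addLaws.tr_id]
  exact T.addLaws.res_id _ _

theorem res_trMul_of_injective {X Y : CSet 𝒯.C} {e : X ⟶ Y} (he : Function.Injective e)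
    (h : 𝒯.mul.IsTransfer e) (m : T.obj X) : T.res e (T.trMul e h m) = m := by
  have hid := mul_isTransfer_of_injective (f := 𝟙 X) fun _ _ h => h
  rw [T.res_trMul (PB.of_injective he) h hid, T.mulLaws.tr_id]
  exact T.mulLaws.res_id _ _

theorem nat_inl (A B : CSet 𝒯.C) : 𝒯.nat.IsTransfer (inl A B) :=
  nat_isTransfer (FiniteFibers.of_bij _ (inl_injective A B))

theorem nat_inr (A B : CSet 𝒯.C) : 𝒯.nat.IsTransfer (inr A B) :=
  nat_isTransfer (FiniteFibers.of_bij _ (inr_injective A B))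

theorem mul_inl (A B : CSet 𝒯.C) : 𝒯.mul.IsTransfer (inl A B) :=
  mul_isTransfer_of_injective (inl_injective A B)

theorem mul_inr (A B : CSet 𝒯.C) : 𝒯.mul.IsTransfer (inr A B) :=
  mul_isTransfer_of_injective (inr_injective A B)

/-- An element of `T(A ⨿ B)` is the sum of the additive transfers of its restrictions, since the
restriction to one summand of a transfer from the other comes from the empty set. -/
theorem eq_trAdd_add {A B : CSet 𝒯.C} (m : T.obj (sum A B)) :
    m = T.trAdd (inl A B) (nat_inl A B) (T.res (inl A B) m)
      + T.trAdd (inr A B) (nat_inr A B) (T.res (inr A B) m) := by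
  have h0 : ∀ (C : CSet 𝒯.C) h (x : T.obj (CSet.empty 𝒯)), T.trAdd (fromEmpty C) h x = 0 := by
    intro C h x
    rw [T.eq_of_isEmpty ⟨fun x => PEmpty.elim x⟩ x 0, map_zero]
  have hf : ∀ C : CSet 𝒯.C, 𝒯.nat.IsTransfer (fromEmpty C) := fun C =>
    nat_isTransfer (FiniteFibers.fromEmpty C)
  refine T.eq_of_res_sum ?_ ?_
  · rw [map_add, T.res_trAdd_of_injective (inl_injective A B),
      T.res_trAdd (PB.inl_inr A B).symm _ (hf A), h0, add_zero]
  · rw [map_add, T.res_trAdd_of_injective (inr_injective A B),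
      T.res_trAdd (PB.inl_inr A B) _ (hf B), h0, zero_add]

/-- The multiplicative counterpart of `eq_trAdd_add`. -/
theorem eq_trMul_mul {A B : CSet 𝒯.C} (m : T.obj (sum A B)) :
    m = T.trMul (inl A B) (mul_inl A B) (T.res (inl A B) m)
      * T.trMul (inr A B) (mul_inr A B) (T.res (inr A B) m) := by
  have h0 : ∀ (C : CSet 𝒯.C) h (x : T.obj (CSet.empty 𝒯)), T.trMul (fromEmpty C) h x = 1 := by
    intro C h x
    rw [T.eq_of_isEmpty ⟨fun x => PEmpty.elim x⟩ x 1, map_one]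
  have hf : ∀ C : CSet 𝒯.C, 𝒯.mul.IsTransfer (fromEmpty C) := fun C =>
    mul_isTransfer_of_injective fun x => PEmpty.elim x
  refine T.eq_of_res_sum ?_ ?_
  · rw [map_mul, T.res_trMul_of_injective (inl_injective A B),
      T.res_trMul (PB.inl_inr A B).symm _ (hf A), h0, mul_one]
  · rw [map_mul, T.res_trMul_of_injective (inr_injective A B),
      T.res_trMul (PB.inl_inr A B) _ (hf B), h0, one_mul]

theorem trAdd_elim {A B X : CSet 𝒯.C} {p : A ⟶ X} {q : B ⟶ X} (hp : 𝒯.nat.IsTransfer p)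
    (hq : 𝒯.nat.IsTransfer q) (h : 𝒯.nat.IsTransfer (elim p q)) (m : T.obj (sum A B)) :
    T.trAdd (elim p q) h m = T.trAdd p hp (T.res (inl A B) m) + T.trAdd q hq (T.res (inr A B) m) := by
  conv_lhs => rw [T.eq_trAdd_add m]
  rw [map_add]
  exact congrArg₂ (· + ·) (T.addLaws.tr_comp _ _ (nat_inl A B) h hp _).symm
    (T.addLaws.tr_comp _ _ (nat_inr A B) h hq _).symm

/-- The product of `T(X)` is the multiplicative transfer along the codiagonal of `X`. -/
theorem trMul_codiag {X : CSet 𝒯.C} (m : T.obj (sum X X)) :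
    T.trMul (codiag X) (codiag_isTransfer X) m = T.res (inl X X) m * T.res (inr X X) m := by
  have hid : 𝒯.mul.IsTransfer (𝟙 X) := mul_isTransfer_of_injective fun _ _ h => h
  conv_lhs => rw [T.eq_trMul_mul m]
  rw [map_mul]
  refine congrArg₂ (· * ·) ?_ ?_
  · exact (T.mulLaws.tr_comp _ _ (mul_inl X X) (codiag_isTransfer X) hid _).symm.trans
      (T.mulLaws.tr_id _ _ _)
  · exact (T.mulLaws.tr_comp _ _ (mul_inr X X) (codiag_isTransfer X) hid _).symm.trans
      (T.mulLaws.tr_id _ _ _)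

/-- Additive transfers multiply by fibered products. This is the exponential law over the
codiagonal of `X`, applied to the element of `T(A ⨿ B)` with restrictions `a` and `b`. -/
theorem trAdd_mul_trAdd {A B X : CSet 𝒯.C} {p : A ⟶ X} {q : B ⟶ X} (hp : 𝒯.nat.IsTransfer p)
    (hq : 𝒯.nat.IsTransfer q) (h : 𝒯.nat.IsTransfer (fst p q ≫ p)) (a : T.obj A) (b : T.obj B) :
    T.trAdd (fst p q ≫ p) h (T.res (fst p q) a * T.res (snd p q) b)
      = T.trAdd p hp a * T.trAdd q hq b := by
  have hs : 𝒯.nat.IsTransfer (sumMap p q) := nat_isTransfer (hp.1.sumMap hq.1)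
  obtain ⟨m, hml, hmr⟩ : ∃ m : T.obj (sum A B), T.res (inl A B) m = a ∧ T.res (inr A B) m = b :=
    ⟨_, ((forgetMul 𝒯).obj T).res_glue a b⟩
  have key := T.exponential _ _ _ _ _
    ((isExp_codiag p q).isExponential (codiag_isTransfer X) hs) (codiag_isTransfer X) hs
    (codiag_isTransfer _) h m
  have h1 : PB (inl A B) p (sumMap p q) (inl X X) := by
    refine ⟨fun _ => rfl, ?_, fun _ _ e _ => Sum.inl_injective e⟩
    rintro (z | z) x e
    · exact ⟨z, rfl, Sum.inl_injective e⟩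
    · exact (Sum.inr_ne_inl e).elim
  have h2 : PB (inr A B) q (sumMap p q) (inr X X) := by
    refine ⟨fun _ => rfl, ?_, fun _ _ e _ => Sum.inr_injective e⟩
    rintro (z | z) x e
    · exact (Sum.inl_ne_inr e).elim
    · exact ⟨z, rfl, Sum.inr_injective e⟩
  rw [T.trMul_codiag, T.trMul_codiag, T.res_trAdd h1 hs hp, T.res_trAdd h2 hs hq, hml, hmr,
    T.res_res, T.res_res] at key
  refine Eq.trans ?_ key
  refine congrArg (T.trAdd _ h) (congrArg₂ (· * ·) ?_ ?_)
  · rw [← hml]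
    exact T.res_res _ _ _
  · rw [← hmr]
    exact T.res_res _ _ _

/-! ### Evaluation of additive transfers -/

/-- The map `𝒮_{μ T}(X) → T(X)`, `(A → X, m) ↦ T_+(A → X)(m)`. It is defined on chosen
representatives; `evalFun_cls` shows that any representative gives the same value. -/
noncomputable def evalFun {X : CSet 𝒯.C} (s : SM ((forgetMul 𝒯).obj T) X) : T.obj X :=
  T.trAdd s.rep.p s.rep.hp s.rep.m

theorem evalFun_cls {A X : CSet 𝒯.C} {p : A ⟶ X} {hp : FiniteFibers p}
    (a : ((forgetMul 𝒯).obj T).obj A) :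
    T.evalFun (SM.cls p hp a) = T.trAdd p (nat_isTransfer hp) a := by
  obtain ⟨e, he, hep, hea⟩ := SM.rep_spec p hp a
  have hp' := (SM.cls p hp a).rep.hp
  have ht : 𝒯.nat.IsTransfer e := nat_isTransfer (FiniteFibers.of_bij e he.1)
  have hc : ∀ (q : A ⟶ X) (hq : 𝒯.nat.IsTransfer q), e ≫ (SM.cls p hp a).rep.p = q →
      T.trAdd q hq a = T.trAdd _ hp' (T.trAdd e ht a) := by
    rintro _ hq rfl
    exact T.addLaws.tr_comp e _ ht hp' hq a
  refine Eq.symm ((hc p _ (hom_ext' hep)).trans (congrArg (T.trAdd _ hp') ?_))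
  exact (congrArg (T.trAdd e ht) hea.symm).trans (T.trAdd_res he ht _)

/-- The semiring homomorphism `𝒮_{μ T}(X) → T(X)`. -/
noncomputable def eval (X : CSet 𝒯.C) : SM ((forgetMul 𝒯).obj T) X →+* T.obj X where
  toFun := T.evalFun
  map_zero' := by
    refine (T.evalFun_cls (hp := FiniteFibers.fromEmpty X) _).trans ?_
    exact (congrArg (T.trAdd (fromEmpty X) _)
      (T.eq_of_isEmpty ⟨fun x => PEmpty.elim x⟩ _ 0)).trans (map_zero _)
  map_one' := (T.evalFun_cls (hp := FiniteFibers.id X) _).trans (T.addLaws.tr_id _ _ _)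
  map_add' s t := by
    induction s using SM.ind with | h A p hp a =>
    induction t using SM.ind with | h B q hq b =>
    rw [SM.add_cls', evalFun_cls, evalFun_cls, evalFun_cls]
    refine (T.trAdd_elim (nat_isTransfer hp) (nat_isTransfer hq) _ _).trans ?_
    have h := ((forgetMul 𝒯).obj T).res_glue a b
    exact congrArg₂ (T.trAdd p _ · + T.trAdd q _ ·) h.1 h.2
  map_mul' s t := by
    induction s using SM.ind with | h A p hp a =>
    induction t using SM.ind with | h B q hq b =>
    rw [SM.mul_cls', evalFun_cls, evalFun_cls, evalFun_cls]
    exact T.trAdd_mul_trAdd (nat_isTransfer hp) (nat_isTransfer hq) _ a b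

end SemiTambara

/-! ### Unit and counit -/

namespace Tambarization

variable {G : Type u} [Group G] {𝒯 : TambaraSystem G}

/-- The morphism `M → μ 𝒮_M`, `m ↦ (X = X, m)`. -/
noncomputable def unitHom (M : SemiMackey 𝒯.mul) :
    SemiMackey.Hom M ((SemiTambara.forgetMul 𝒯).obj M.tambarization) where
  app X :=
    { toFun := fun m => SM.cls (𝟙 X) (FiniteFibers.id X) m
      map_one' := rfl
      map_mul' := fun m n => (SM.mul_cls (PB.of_injective (e := 𝟙 X) fun _ _ h => h) _ _
        (fun _ => rfl) _ (by rw [M.res_id, M.res_id])).symm }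
  res_comm {X Y} f m := (SM.res_cls (hp := FiniteFibers.id Y) (ζ' := f) (p' := 𝟙 X)
    ⟨fun _ => rfl, fun _ y h => ⟨y, Eq.symm h, rfl⟩, fun _ _ _ h => h⟩ (FiniteFibers.id X)).symm
  tr_comm {X Y} f hf m := ((SM.trMul_cls (hp := FiniteFibers.id X) (hη := hf) (isExp_of_id f) hf
    (FiniteFibers.id Y)).trans (congrArg (fun a => SM.cls (𝟙 Y) (FiniteFibers.id Y) (M.tr f hf a))
      (M.res_id X m))).symm

/-- The morphism `𝒮_{μ T} → T`, `(A → X, m) ↦ T_+(A → X)(m)`. -/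
noncomputable def counitHom (T : SemiTambara 𝒯) :
    SemiTambara.Hom ((SemiTambara.forgetMul 𝒯).obj T).tambarization T where
  app := T.eval
  res_comm f s := by
    show T.evalFun (SM.resFun f s) = T.res f (T.evalFun s)
    induction s using SM.ind with | h A p hp a =>
    rw [SM.res_cls', T.evalFun_cls, T.evalFun_cls]
    exact (T.res_trAdd (pb_PB p f) _ _ a).symm
  trAdd_comm f hf s := by
    show T.evalFun (SM.trAddFun f hf s) = T.trAdd f hf (T.evalFun s)
    induction s using SM.ind with | h A p hp a =>
    rw [SM.trAdd_cls, T.evalFun_cls, T.evalFun_cls]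
    exact T.addLaws.tr_comp p f _ _ _ a
  trMul_comm f hf s := by
    show T.evalFun (SM.trMulFun f hf s) = T.trMul f hf (T.evalFun s)
    induction s using SM.ind with | h A p hp a =>
    rw [SM.trMul_cls', T.evalFun_cls, T.evalFun_cls]
    exact T.exponential _ _ _ _ _ ((isExp_pi f hf.1 p).isExponential hf (nat_isTransfer hp))
      hf _ _ _ a

variable (𝒯)

/-- The adjunction `𝒮 ⊣ μ`, with unit `unitHom` and counit `counitHom`. -/
noncomputable def adjunction : tambarization 𝒯 ⊣ SemiTambara.forgetMul 𝒯 where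
  unit :=
    { app := unitHom
      naturality := fun M N φ => SemiMackey.Hom.ext (funext fun X => MonoidHom.ext fun m => by
        show SM.cls (𝟙 X) (FiniteFibers.id X) (SemiMackey.Hom.app φ X m)
          = SM.mapFun φ (SM.cls (𝟙 X) (FiniteFibers.id X) m)
        exact (SM.map_cls φ).symm) }
  counit :=
    { app := counitHom
      naturality := fun S T ψ => SemiTambara.Hom.ext (funext fun X => RingHom.ext fun s => by
        show T.evalFun (SM.mapFun ((SemiTambara.forgetMul 𝒯).map ψ) s)
          = SemiTambara.Hom.app ψ X (S.evalFun s)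
        induction s using SM.ind with | h A p hp a =>
        rw [SM.map_cls, T.evalFun_cls, S.evalFun_cls]
        exact (SemiTambara.Hom.trAdd_comm ψ p _ a).symm) }
  left_triangle_components M := by
    refine SemiTambara.Hom.ext (funext fun X => RingHom.ext fun s => ?_)
    let ι : M ⟶ (SemiTambara.forgetMul 𝒯).obj M.tambarization := unitHom M
    show M.tambarization.evalFun (SM.mapFun ι s) = s
    induction s using SM.ind with | h A p hp a =>
    rw [SM.map_cls, SemiTambara.evalFun_cls]
    exact SM.trAdd_cls (hp := FiniteFibers.id A) (hξ := nat_isTransfer hp)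
  right_triangle_components T := by
    refine SemiMackey.Hom.ext (funext fun X => MonoidHom.ext fun m => ?_)
    show T.evalFun (SM.cls (𝟙 X) (FiniteFibers.id X) m) = m
    rw [T.evalFun_cls]
    exact T.addLaws.tr_id _ _ _

end Tambarization

theorem theorem2 {G : Type*} [Group G] (𝒯 : TambaraSystem G) :
    Nonempty (tambarization 𝒯 ⊣ SemiTambara.forgetMul 𝒯) :=
  ⟨Tambarization.adjunction 𝒯⟩
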